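/- Let $\mathcal M=\mathbb R$ or $\mathcal M=\mathbb T=\mathbb R/\mathbb Z$, let $k\ge 2$ be an integer, $s<0$ and $T>0$. All functions are real-valued, or all are complex-valued (the result holds in both settings). Consider the generalized improved Boussinesq equation $$\partial_t^2u-\partial_x^2u-\partial_t^2\partial_x^2u=\partial_x^2(u^k),\qquad (u,\partial_tu)|_{t=0}=(u_0,u_1),\qquad (t,x)\in\mathbb R\times\mathcal M. \tag{1}$$ Put $W^{s,2,\infty}(\mathcal M)=\langle\nabla\rangle^{-s}(L^2\cap L^\infty)(\mathcal M)$ with norm $\|f\|_{W^{s,2,\infty}}=\|\langle\nabla\rangle^sf\|_{L^2\cap L^\infty}$, and $\mathcal W^{s}=W^{s,2,\infty}(\mathcal M)\times W^{s,2,\infty}(\mathcal M)$. The solution map $\Phi:(u_0,u_1)\mapsto(u,\partial_tu)$ is defined on the data $(u_0,u_1)\in\mathcal R$ with $u_0,u_1\in (L^2\cap L^\infty)(\mathcal M)\subset W^{s,2,\infty}(\mathcal M)$; solutions of (1) are of class $C^2$ in time with values in $(L^2\cap L^\infty)(\mathcal M)$, on an interval $[-\tau,\tau]$ with $0<\tau\le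 T$. Say that $\Phi$ is *continuous at* $p\in\mathcal W^s$ if $p$ belongs to the closure of $\mathcal R$ in $\mathcal W^s$ and there is $L=(L_0,L_1)\in C([-T,T];W^{s,2,\infty}(\mathcal M))^2$ (a value for $\Phi(p)$) such that for every $\varepsilon>0$ there is $\delta>0$ for which every solution $u$ of (1) on an interval $[-\tau,\tau]$, $0<\tau\le T$, whose data $(u_0,u_1)\in\mathcal R$ satisfy $\|(u_0,u_1)-p\|_{\mathcal W^s}<\delta$, obeys $$\|u(t)-L_0(t)\|_{W^{s,2,\infty}}<\varepsilon\quad\text{and}\quad\|\partial_tu(t)-L_1(t)\|_{W^{s,2,\infty}}<\varepsilon\qquad\text{for all }t\in[-\tau,\tau].$$ Then the solution map $\Phi$ from $\mathcal W^s$ into $C([-T,T];W^{s,2,\infty}(\mathcal M))^2$ is discontinuous everywhere: at no point $p\in\mathcal W^s$ is $\Phi$ continuous. (The content is at the points $p$ of the closure of $\mathcal R$, in particular at every point of $\mathcal R$; near any other point there are no data in $\mathcal R$, and $\Phi$ has no limit there for lack of nearby data.) -/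

import Mathlib

open MeasureTheory TemperedDistribution
open scoped SchwartzMap ENNReal

noncomputable section

namespace GIBq

/-- The spatial domain: the real line `ℝ`, or the torus `𝕋 = ℝ / ℤ`. Functions and distributions
on the torus are identified with `1`-periodic functions and (tempered) distributions on `ℝ`. -/
inductive SpatialDomain
  | line
  | torus

/-- The measure over which square integrals are taken: Lebesgue measure on `ℝ`, respectively
Lebesgue measure on a fundamental domain of `ℝ / ℤ`. -/
def SpatialDomain.measure : SpatialDomain → Measure ℝ
  | .line => volume
  | .torus => volume.restrict (Set.Ioc 0 1)

theorem SpatialDomain.measure_absolutelyContinuous (M : SpatialDomain) :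
    M.measure ≪ (volume : Measure ℝ) := by
  cases M
  · exact Measure.AbsolutelyContinuous.rfl
  · exact Measure.absolutelyContinuous_of_le Measure.restrict_le_self

/-- The space `(L² ∩ L^∞)(M)` of functions with values in `𝕂`, where `𝕂` is a real subalgebra of
`ℂ`, that is `⊥` (real-valued functions) or `⊤` (complex-valued functions). An element is a class
in `L^∞` together with the same class seen in `L²`, and the norm is
`max (‖g‖_{L^∞}) (‖g‖_{L²})`. -/
def L2Linf (𝕂 : Subalgebra ℝ ℂ) (M : SpatialDomain) :
    Submodule ℝ (Lp ℂ ∞ (volume : Measure ℝ) × Lp ℂ 2 M.measure) where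
  carrier := {g | (g.1 : ℝ → ℂ) =ᵐ[M.measure] (g.2 : ℝ → ℂ) ∧
    (∀ᵐ x : ℝ, (g.1 : ℝ → ℂ) x ∈ 𝕂) ∧
    (M = .torus → ∀ᵐ x : ℝ, (g.1 : ℝ → ℂ) (x + 1) = (g.1 : ℝ → ℂ) x)}
  add_mem' := by
    rintro f g ⟨hf, hf', hf''⟩ ⟨hg, hg', hg''⟩
    have h1 : ((f.1 + g.1 : Lp ℂ ∞ (volume : Measure ℝ)) : ℝ → ℂ) =ᵐ[volume] f.1 + g.1 :=
      Lp.coeFn_add _ _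
    refine ⟨?_, ?_, fun hM => ?_⟩
    · filter_upwards [hf, hg, M.measure_absolutelyContinuous.ae_le h1,
        Lp.coeFn_add f.2 g.2] with x a b c d
      rw [Prod.fst_add, Prod.snd_add, c, d, Pi.add_apply, Pi.add_apply, a, b]
    · filter_upwards [hf', hg', h1] with x a b c
      rw [Prod.fst_add, c]
      exact 𝕂.add_mem a b
    · have h2 := (measurePreserving_add_right (volume : Measure ℝ) 1).quasiMeasurePreserving.ae h1
      filter_upwards [hf'' hM, hg'' hM, h1, h2] with x a b c d
      rw [Prod.fst_add, c, d, Pi.add_apply, Pi.add_apply, a, b]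
  zero_mem' := by
    have h1 : ((0 : Lp ℂ ∞ (volume : Measure ℝ)) : ℝ → ℂ) =ᵐ[volume] 0 := Lp.coeFn_zero _ _ _
    refine ⟨?_, ?_, fun hM => ?_⟩
    · filter_upwards [M.measure_absolutelyContinuous.ae_le h1,
        Lp.coeFn_zero ℂ 2 M.measure] with x a b
      rw [Prod.fst_zero, Prod.snd_zero, a, b]
    · filter_upwards [h1] with x a
      rw [Prod.fst_zero, a]
      exact 𝕂.zero_mem
    · have h2 := (measurePreserving_add_right (volume : Measure ℝ) 1).quasiMeasurePreserving.ae h1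
      filter_upwards [h1, h2] with x a b
      rw [Prod.fst_zero, a, b, Pi.zero_apply, Pi.zero_apply]
  smul_mem' := by
    rintro r f ⟨hf, hf', hf''⟩
    have h1 : ((r • f.1 : Lp ℂ ∞ (volume : Measure ℝ)) : ℝ → ℂ) =ᵐ[volume] r • ⇑f.1 :=
      Lp.coeFn_smul _ _
    refine ⟨?_, ?_, fun hM => ?_⟩
    · filter_upwards [hf, M.measure_absolutelyContinuous.ae_le h1,
        Lp.coeFn_smul r f.2] with x a c d
      rw [Prod.smul_fst, Prod.smul_snd, c, d, Pi.smul_apply, Pi.smul_apply, a]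
    · filter_upwards [hf', h1] with x a c
      rw [Prod.smul_fst, c]
      exact 𝕂.smul_mem a r
    · have h2 := (measurePreserving_add_right (volume : Measure ℝ) 1).quasiMeasurePreserving.ae h1
      filter_upwards [hf'' hM, h1, h2] with x a c d
      rw [Prod.smul_fst, c, d, Pi.smul_apply, Pi.smul_apply, a]

variable {𝕂 : Subalgebra ℝ ℂ} {M : SpatialDomain} {s : ℝ}

/-- The underlying function, through a representative of the almost everywhere class. -/
def L2Linf.fn (g : L2Linf 𝕂 M) : ℝ → ℂ := (g.1.1 : ℝ → ℂ)

/-- The tempered distribution `ψ ↦ ∫ g ψ` defined by `g ∈ L² ∩ L^∞`. -/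
def L2Linf.toDist : L2Linf 𝕂 M →ₗ[ℝ] 𝓢'(ℝ, ℂ) :=
  ((Lp.toTemperedDistributionCLM ℂ (volume : Measure ℝ) ∞).toLinearMap.restrictScalars ℝ) ∘ₗ
    LinearMap.fst ℝ _ _ ∘ₗ (L2Linf 𝕂 M).subtype

theorem L2Linf.toDist_apply (g : L2Linf 𝕂 M) (ψ : 𝓢(ℝ, ℂ)) :
    L2Linf.toDist g ψ = ∫ x, ψ x * L2Linf.fn g x :=
  Lp.toTemperedDistribution_apply g.1.1 ψ

theorem L2Linf.toDist_injective :
    Function.Injective (L2Linf.toDist : L2Linf 𝕂 M →ₗ[ℝ] 𝓢'(ℝ, ℂ)) := by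
  rintro ⟨⟨f₁, f₂⟩, hf, _⟩ ⟨⟨g₁, g₂⟩, hg, _⟩ h
  have h1 : f₁ = g₁ :=
    LinearMap.ker_eq_bot.1 (Lp.ker_toTemperedDistributionCLM_eq_bot (F := ℂ)
      (μ := (volume : Measure ℝ)) (p := ∞)) h
  subst h1
  have h2 : f₂ = g₂ := Lp.ext (hf.symm.trans hg)
  subst h2
  rfl

/-- The map `g ↦ ⟨∇⟩^{-s} g` from `(L² ∩ L^∞)(M)` to distributions. -/
def besselEmbedding (𝕂 : Subalgebra ℝ ℂ) (M : SpatialDomain) (s : ℝ) :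
    L2Linf 𝕂 M →ₗ[ℝ] 𝓢'(ℝ, ℂ) :=
  ((besselPotential ℝ ℂ (-s)).toLinearMap.restrictScalars ℝ) ∘ₗ L2Linf.toDist

theorem besselEmbedding_apply (g : L2Linf 𝕂 M) :
    besselEmbedding 𝕂 M s g = besselPotential ℝ ℂ (-s) (L2Linf.toDist g) := rfl

theorem besselEmbedding_injective (𝕂 : Subalgebra ℝ ℂ) (M : SpatialDomain) (s : ℝ) :
    Function.Injective (besselEmbedding 𝕂 M s) := by
  intro f g h
  rw [besselEmbedding_apply, besselEmbedding_apply] at h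
  have h' := congrArg (besselPotential ℝ ℂ s) h
  simp only [besselPotential_besselPotential_apply, neg_add_cancel, besselPotential_zero,
    ContinuousLinearMap.id_apply] at h'
  exact L2Linf.toDist_injective h'

/-- The space `W^{s,2,∞}(M) = ⟨∇⟩^{-s} (L² ∩ L^∞)(M)` of tempered distributions (`1`-periodic ones
if `M` is the torus), with `𝕂` the field of values. It is given its own name because its topology
is the norm topology below, not the one induced by `𝓢'`. -/
def W (𝕂 : Subalgebra ℝ ℂ) (M : SpatialDomain) (s : ℝ) : Type :=
  LinearMap.range (besselEmbedding 𝕂 M s)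

instance : AddCommGroup (W 𝕂 M s) :=
  inferInstanceAs (AddCommGroup (LinearMap.range (besselEmbedding 𝕂 M s)))

instance : Module ℝ (W 𝕂 M s) :=
  inferInstanceAs (Module ℝ (LinearMap.range (besselEmbedding 𝕂 M s)))

/-- The tempered distribution underlying an element of `W^{s,2,∞}(M)`. -/
def W.toDist : W 𝕂 M s →ₗ[ℝ] 𝓢'(ℝ, ℂ) :=
  (LinearMap.range (besselEmbedding 𝕂 M s)).subtype

/-- `⟨∇⟩^s f ∈ (L² ∩ L^∞)(M)` for `f ∈ W^{s,2,∞}(M)`. -/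
def W.bessel : W 𝕂 M s ≃ₗ[ℝ] L2Linf 𝕂 M :=
  (LinearEquiv.ofInjective _ (besselEmbedding_injective 𝕂 M s)).symm

/-- `‖f‖_{W^{s,2,∞}} = ‖⟨∇⟩^s f‖_{L² ∩ L^∞}`. -/
instance : NormedAddCommGroup (W 𝕂 M s) :=
  NormedAddCommGroup.induced (W 𝕂 M s) (L2Linf 𝕂 M) W.bessel W.bessel.injective

theorem W.norm_def (f : W 𝕂 M s) : ‖f‖ = ‖W.bessel f‖ := rfl

theorem W.toDist_bessel (f : W 𝕂 M s) :
    L2Linf.toDist (W.bessel f) = besselPotential ℝ ℂ s f.toDist := by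
  have h : besselEmbedding 𝕂 M s (W.bessel f) = f.toDist :=
    congrArg Subtype.val
      ((LinearEquiv.ofInjective _ (besselEmbedding_injective 𝕂 M s)).apply_symm_apply f)
  rw [← h, besselEmbedding_apply]
  simp

/-- `u ∈ C²([-τ, τ]; (L² ∩ L^∞)(M))`, with `∂ₜ u = v` and `∂ₜ² u = w`, satisfies
`∂ₜ² u - ∂ₓ² u - ∂ₜ² ∂ₓ² u = ∂ₓ² (u ^ k)` at each time of `[-τ, τ]`, in the sense of distributions
in the space variable. -/
structure IsRegularSolution (k : ℕ) (τ : ℝ) (u v w : ℝ → L2Linf 𝕂 M) : Prop where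
  hasDeriv_u : ∀ t ∈ Set.Icc (-τ) τ, HasDerivWithinAt u (v t) (Set.Icc (-τ) τ) t
  hasDeriv_v : ∀ t ∈ Set.Icc (-τ) τ, HasDerivWithinAt v (w t) (Set.Icc (-τ) τ) t
  continuous_w : ContinuousOn w (Set.Icc (-τ) τ)
  equation : ∀ t ∈ Set.Icc (-τ) τ, ∀ ψ : 𝓢(ℝ, ℂ),
    (∫ x, L2Linf.fn (w t) x * ψ x) - (∫ x, L2Linf.fn (u t) x * deriv (deriv ψ) x)
      - (∫ x, L2Linf.fn (w t) x * deriv (deriv ψ) x) = ∫ x, L2Linf.fn (u t) x ^ k * deriv (deriv ψ) x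

/-- The pair `(U, V) ∈ C([-τ, τ]; W^{s,2,∞}(M))²` is `(u, ∂ₜ u)` for a solution `u` of the
generalized improved Boussinesq equation on `[-τ, τ] × M` with initial data
`(u, ∂ₜ u)|_{t = 0} = q`, where `u` is of class `C²` in time with values in `(L² ∩ L^∞)(M)`. -/
def IsSolution (k : ℕ) (τ : ℝ) (q : W 𝕂 M s × W 𝕂 M s)
    (U V : C(Set.Icc (-τ) τ, W 𝕂 M s)) : Prop :=
  (∀ t : Set.Icc (-τ) τ, (t : ℝ) = 0 → U t = q.1 ∧ V t = q.2) ∧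
  ∃ u v w : ℝ → L2Linf 𝕂 M, IsRegularSolution k τ u v w ∧
    ∀ t : Set.Icc (-τ) τ,
      (U t).toDist = L2Linf.toDist (u t) ∧ (V t).toDist = L2Linf.toDist (v t)

/-- The data on which the equation is well-posed and the solution map is classically defined:
pairs of elements of `W^{s,2,∞}(M)` which belong to `(L² ∩ L^∞)(M)`. -/
def regularData (𝕂 : Subalgebra ℝ ℂ) (M : SpatialDomain) (s : ℝ) : Set (W 𝕂 M s × W 𝕂 M s) :=
  {q | (∃ a : L2Linf 𝕂 M, q.1.toDist = L2Linf.toDist a) ∧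
    (∃ b : L2Linf 𝕂 M, q.2.toDist = L2Linf.toDist b)}

/-- The solutions with data close to `p` are close to `L` in `C([-T, T]; W^{s,2,∞}(M))²`. A solution
which is not known to exist on the whole of `[-T, T]` is compared with `L` on the interval
`[-τ, τ]` on which it exists. -/
def SolutionsConverge (k : ℕ) (T : ℝ) (p : W 𝕂 M s × W 𝕂 M s)
    (L : C(Set.Icc (-T) T, W 𝕂 M s) × C(Set.Icc (-T) T, W 𝕂 M s)) : Prop :=
  ∀ ε > 0, ∃ δ > 0, ∀ q : W 𝕂 M s × W 𝕂 M s, ‖q - p‖ < δ →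
    ∀ (τ : ℝ) (_ : 0 < τ) (hτT : τ ≤ T) (U V : C(Set.Icc (-τ) τ, W 𝕂 M s)),
      IsSolution k τ q U V → ∀ t : Set.Icc (-τ) τ,
        ‖U t - L.1 (Set.inclusion (Set.Icc_subset_Icc (neg_le_neg hτT) hτT) t)‖ < ε ∧
        ‖V t - L.2 (Set.inclusion (Set.Icc_subset_Icc (neg_le_neg hτT) hτT) t)‖ < ε

/-- The solution map `Φ : (u₀, u₁) ↦ (u, ∂ₜ u) ∈ C([-T, T]; W^{s,2,∞}(M))²` is continuous at `p`,
for some choice of the value `L = Φ(p)`: there are regular data arbitrarily close to `p`, and the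
solutions converge to `L` as their data converge to `p`. -/
def SolutionMapContinuousAt (k : ℕ) (T : ℝ) (p : W 𝕂 M s × W 𝕂 M s) : Prop :=
  p ∈ closure (regularData 𝕂 M s) ∧
    ∃ L : C(Set.Icc (-T) T, W 𝕂 M s) × C(Set.Icc (-T) T, W 𝕂 M s), SolutionsConverge k T p L

end GIBq

end

open MeasureTheory TemperedDistribution
open scoped SchwartzMap ENNReal

noncomputable section

namespace GIBq

variable {𝕂 : Subalgebra ℝ ℂ} {M : SpatialDomain} {s : ℝ}

/-! High-frequency data that are invisible in a norm of negative regularity still feed low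
frequencies through the nonlinearity, and this produces norm inflation near every point. Write `k =
n + 1` and put (1) in the form `∂ₜ² u = N(u)`, with `N(u) = ∂² (1 - ∂²)⁻¹ (u + u^k)`. Since `∂² (1 -
∂²)⁻¹` is convolution with an integrable kernel minus the identity, this is an ODE with a locally
Lipschitz right-hand side in the Banach space `L² ∩ L^∞`.

Let `g` oscillate fast, with values `2` on one third and `-1` on two thirds of each half period. Its
mean is zero, so `⟨∇⟩^s g` is small in `L² ∩ L^∞`; but `g^k` converges weakly to the nonzero
constant `(2^k + 2 (-1)^k) / 3` on the half cells (`exists_oscillating_data`). The values are real,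
so that one profile serves both fields.

Suppose that the map is continuous at `p`. Take regular data `(a, b)` near `p` and perturb them to
`(a + R g, b)`. On the time scale `τ = 1 / (c R^n)` the solution exists and `v(τ) = b + τ N(a + R g)
+ O(1)`, uniformly in `R` (`exists_regularSolution`). Tested against `ψ - ψ''`, the term `τ R^k g^k`
contributes a quantity of size at least a constant times `R`, and all the others are `O(1)`
(`growth_le`). Continuity bounds `v(τ)` independently of `R`, while `g` may be chosen after `R` so
that `R g` is as small as desired in `W^{s,2,∞}`. A large `R` gives the contradiction. -/

/-! ### The Banach space `(L² ∩ L^∞)(M)` and its power map -/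

/-- The functions whose class belongs to `(L² ∩ L^∞)(M)`. -/
structure IsAdmissible (𝕂 : Subalgebra ℝ ℂ) (M : SpatialDomain) (f : ℝ → ℂ) : Prop where
  memLp_top : MemLp f ∞ volume
  memLp_two : MemLp f 2 M.measure
  ae_mem : ∀ᵐ x : ℝ, f x ∈ 𝕂
  ae_periodic : M = .torus → ∀ᵐ x : ℝ, f (x + 1) = f x

/-- The element of `(L² ∩ L^∞)(M)` given by an admissible function. -/
def ofFun {f : ℝ → ℂ} (hf : IsAdmissible 𝕂 M f) : L2Linf 𝕂 M :=
  ⟨(hf.memLp_top.toLp f, hf.memLp_two.toLp f), by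
    have h1 := hf.memLp_top.coeFn_toLp
    refine ⟨?_, ?_, fun hM => ?_⟩
    · exact (M.measure_absolutelyContinuous.ae_eq h1).trans hf.memLp_two.coeFn_toLp.symm
    · filter_upwards [h1, hf.ae_mem] with x a b
      rwa [a]
    · have h2 := (measurePreserving_add_right (volume : Measure ℝ) 1).quasiMeasurePreserving.ae h1
      filter_upwards [h1, h2, hf.ae_periodic hM] with x a b c
      rw [a, b, c]⟩

theorem fn_ofFun {f : ℝ → ℂ} (hf : IsAdmissible 𝕂 M f) : L2Linf.fn (ofFun hf) =ᵐ[volume] f :=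
  hf.memLp_top.coeFn_toLp

theorem fn_ae_eq_snd (g : L2Linf 𝕂 M) : L2Linf.fn g =ᵐ[M.measure] (g.1.2 : ℝ → ℂ) := g.2.1

theorem isAdmissible_fn (g : L2Linf 𝕂 M) : IsAdmissible 𝕂 M (L2Linf.fn g) where
  memLp_top := Lp.memLp g.1.1
  memLp_two := (Lp.memLp g.1.2).ae_eq (fn_ae_eq_snd g).symm
  ae_mem := g.2.2.1
  ae_periodic := g.2.2.2

theorem ext_fn {f g : L2Linf 𝕂 M} (h : L2Linf.fn f =ᵐ[volume] L2Linf.fn g) : f = g := by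
  apply Subtype.ext
  apply Prod.ext
  · exact Lp.ext h
  · exact Lp.ext ((fn_ae_eq_snd f).symm.trans
      ((M.measure_absolutelyContinuous.ae_eq h).trans (fn_ae_eq_snd g)))

theorem fn_add (f g : L2Linf 𝕂 M) :
    L2Linf.fn (f + g) =ᵐ[volume] fun x => L2Linf.fn f x + L2Linf.fn g x :=
  Lp.coeFn_add f.1.1 g.1.1

theorem fn_sub (f g : L2Linf 𝕂 M) :
    L2Linf.fn (f - g) =ᵐ[volume] fun x => L2Linf.fn f x - L2Linf.fn g x :=
  Lp.coeFn_sub f.1.1 g.1.1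

theorem fn_smul (c : ℝ) (f : L2Linf 𝕂 M) :
    L2Linf.fn (c • f) =ᵐ[volume] fun x => (c : ℂ) * L2Linf.fn f x := by
  filter_upwards [Lp.coeFn_smul c f.1.1] with x hx
  rw [← Complex.real_smul]
  exact hx

theorem fn_zero : L2Linf.fn (0 : L2Linf 𝕂 M) =ᵐ[volume] fun _ => 0 :=
  Lp.coeFn_zero ℂ ∞ volume

theorem norm_eq_max (g : L2Linf 𝕂 M) : ‖g‖ = max ‖g.1.1‖ ‖g.1.2‖ := rfl

theorem ae_norm_fn_le (g : L2Linf 𝕂 M) : ∀ᵐ x : ℝ, ‖L2Linf.fn g x‖ ≤ ‖g‖ := by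
  have h : ∀ᵐ x : ℝ, ‖(g.1.1 : ℝ → ℂ) x‖ₑ ≤ eLpNormEssSup g.1.1 volume := ae_le_eLpNormEssSup
  filter_upwards [h] with x hx
  rw [norm_eq_max]
  refine le_max_of_le_left ?_
  rw [Lp.norm_def, eLpNorm_exponent_top]
  have h2 : eLpNormEssSup (g.1.1 : ℝ → ℂ) volume ≠ ∞ := by
    have := (Lp.memLp g.1.1).2.ne
    rwa [eLpNorm_exponent_top] at this
  have := ENNReal.toReal_mono h2 hx
  rwa [toReal_enorm] at this

theorem norm_le_of_ae_le {F G : L2Linf 𝕂 M} {C : ℝ}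
    (h : ∀ᵐ x : ℝ, ‖L2Linf.fn F x‖ ≤ C * ‖L2Linf.fn G x‖) (hC : 0 ≤ C) : ‖F‖ ≤ C * ‖G‖ := by
  rw [norm_eq_max F]
  refine max_le ?_ ?_
  · exact (Lp.norm_le_mul_norm_of_ae_le_mul h).trans
      (mul_le_mul_of_nonneg_left (le_max_left _ _) hC)
  · refine (Lp.norm_le_mul_norm_of_ae_le_mul (g := G.1.2) ?_).trans
      (mul_le_mul_of_nonneg_left (le_max_right _ _) hC)
    filter_upwards [M.measure_absolutelyContinuous.ae_le h, fn_ae_eq_snd F, fn_ae_eq_snd G]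
      with x a b c
    rwa [← b, ← c]

theorem lintegral_fn_sq_le (g : L2Linf 𝕂 M) :
    ∫⁻ x, ‖L2Linf.fn g x‖ₑ ^ 2 ∂M.measure ≤ ENNReal.ofReal ‖g‖ ^ 2 := by
  have h1 : eLpNorm (L2Linf.fn g) 2 M.measure ≤ ENNReal.ofReal ‖g‖ := by
    rw [eLpNorm_congr_ae (fn_ae_eq_snd g)]
    have : eLpNorm (g.1.2 : ℝ → ℂ) 2 M.measure = ENNReal.ofReal ‖g.1.2‖ := by
      rw [Lp.norm_def, ENNReal.ofReal_toReal (Lp.memLp g.1.2).2.ne]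
    rw [this]
    exact ENNReal.ofReal_le_ofReal (le_max_right _ _)
  have h2 := pow_le_pow_left' h1 2
  rw [eLpNorm_eq_lintegral_rpow_enorm_toReal (by norm_num) (by norm_num)] at h2
  rw [← ENNReal.rpow_natCast, ← ENNReal.rpow_mul] at h2
  simpa using h2

theorem memLp_two_of_lintegral {f : ℝ → ℂ} {μ : Measure ℝ} (hm : AEStronglyMeasurable f μ)
    {C : ℝ} (h : ∫⁻ x, ‖f x‖ₑ ^ 2 ∂μ ≤ ENNReal.ofReal C ^ 2) :
    MemLp f 2 μ ∧ eLpNorm f 2 μ ≤ ENNReal.ofReal C := by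
  have h1 : eLpNorm f 2 μ ≤ ENNReal.ofReal C := by
    rw [eLpNorm_eq_lintegral_rpow_enorm_toReal (by norm_num) (by norm_num)]
    simp only [ENNReal.toReal_ofNat, ENNReal.rpow_ofNat]
    calc _ ≤ (ENNReal.ofReal C ^ 2) ^ (1 / 2 : ℝ) := by gcongr
      _ = ENNReal.ofReal C := by
        rw [← ENNReal.rpow_natCast, ← ENNReal.rpow_mul]
        simp
  exact ⟨⟨hm, h1.trans_lt ENNReal.ofReal_lt_top⟩, h1⟩

theorem norm_ofFun_le {f : ℝ → ℂ} (hf : IsAdmissible 𝕂 M f) {C : ℝ} (hC : 0 ≤ C)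
    (h1 : ∀ᵐ x : ℝ, ‖f x‖ ≤ C) (h2 : ∫⁻ x, ‖f x‖ₑ ^ 2 ∂M.measure ≤ ENNReal.ofReal C ^ 2) :
    ‖ofFun hf‖ ≤ C := by
  rw [norm_eq_max]
  refine max_le ?_ ?_
  · change ‖hf.memLp_top.toLp f‖ ≤ C
    rw [Lp.norm_toLp, eLpNorm_exponent_top]
    exact ENNReal.toReal_le_of_le_ofReal hC (eLpNormEssSup_le_of_ae_bound h1)
  · change ‖hf.memLp_two.toLp f‖ ≤ C
    rw [Lp.norm_toLp]
    exact ENNReal.toReal_le_of_le_ofReal hC (memLp_two_of_lintegral hf.memLp_two.1 h2).2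

theorem isClosed_subalgebra (𝕂 : Subalgebra ℝ ℂ) : IsClosed (𝕂 : Set ℂ) :=
  (Subalgebra.toSubmodule 𝕂).closed_of_finiteDimensional

/-- Needed for Picard–Lindelöf. Convergence in `L^p` gives almost everywhere convergence along a
subsequence, and each defining condition passes to such a limit. The `L²` subsequence is extracted
from the `L^∞` one, so that both components converge along the same indices. -/
instance : CompleteSpace (L2Linf 𝕂 M) := by
  have hcl : IsClosed ((L2Linf 𝕂 M : Submodule ℝ _) :
      Set (Lp ℂ ∞ (volume : Measure ℝ) × Lp ℂ 2 M.measure)) := by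
    rw [← isSeqClosed_iff_isClosed]
    intro u g hu hg
    have h1 : Filter.Tendsto (fun n => (u n).1) Filter.atTop (nhds g.1) :=
      (continuous_fst.tendsto g).comp hg
    have h2 : Filter.Tendsto (fun n => (u n).2) Filter.atTop (nhds g.2) :=
      (continuous_snd.tendsto g).comp hg
    obtain ⟨φ, hφ, hφ1⟩ := (tendstoInMeasure_of_tendsto_Lp h1).exists_seq_tendsto_ae
    obtain ⟨θ, hθ, hθ1⟩ := (tendstoInMeasure_of_tendsto_Lp
      (h2.comp hφ.tendsto_atTop)).exists_seq_tendsto_ae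
    have hφ2 := M.measure_absolutelyContinuous.ae_le hφ1
    refine ⟨?_, ?_, fun hM => ?_⟩
    · have h3 : ∀ᵐ x ∂M.measure, ∀ n, ((u n).1 : ℝ → ℂ) x = ((u n).2 : ℝ → ℂ) x :=
        ae_all_iff.2 fun n => (hu n).1
      filter_upwards [hφ2, hθ1, h3] with x a b c
      refine tendsto_nhds_unique (a.comp hθ.tendsto_atTop) ?_
      refine b.congr fun n => ?_
      exact (c _).symm
    · have h3 : ∀ᵐ x : ℝ, ∀ n, ((u n).1 : ℝ → ℂ) x ∈ 𝕂 := ae_all_iff.2 fun n => (hu n).2.1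
      filter_upwards [hφ1, h3] with x a b
      exact (isClosed_subalgebra 𝕂).mem_of_tendsto a (Filter.Eventually.of_forall fun n => b _)
    · have h3 : ∀ᵐ x : ℝ, ∀ n, ((u n).1 : ℝ → ℂ) (x + 1) = ((u n).1 : ℝ → ℂ) x :=
        ae_all_iff.2 fun n => (hu n).2.2 hM
      have h4 := (measurePreserving_add_right (volume : Measure ℝ) 1).quasiMeasurePreserving.ae hφ1
      filter_upwards [hφ1, h4, h3] with x a b c
      refine tendsto_nhds_unique b (a.congr fun n => ?_)
      exact (c _).symm
  exact hcl.completeSpace_coe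

/-- The bound `|g^k| ≤ ‖g‖^(k-1) |g|` reduces everything to `g` itself; the exponent zero is
excluded because constants are not square integrable on the line. -/
theorem isAdmissible_pow (k : ℕ) (hk : k ≠ 0) (g : L2Linf 𝕂 M) :
    IsAdmissible 𝕂 M fun x => L2Linf.fn g x ^ k := by
  have hg := isAdmissible_fn g
  have hle : ∀ᵐ x : ℝ, ‖L2Linf.fn g x ^ k‖ ≤ ‖g‖ ^ (k - 1) * ‖L2Linf.fn g x‖ := by
    filter_upwards [ae_norm_fn_le g] with x hx
    obtain ⟨n, rfl⟩ := Nat.exists_eq_succ_of_ne_zero hk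
    rw [norm_pow, pow_succ]
    simp only [Nat.succ_eq_add_one, Nat.add_sub_cancel]
    gcongr
  refine ⟨?_, ?_, ?_, fun hM => ?_⟩
  · exact hg.memLp_top.of_le_mul (hg.memLp_top.1.pow k) hle
  · exact hg.memLp_two.of_le_mul (hg.memLp_two.1.pow k) (M.measure_absolutelyContinuous.ae_le hle)
  · filter_upwards [hg.ae_mem] with x hx using 𝕂.pow_mem hx k
  · filter_upwards [hg.ae_periodic hM] with x hx
    rw [hx]

/-- The power map `g ↦ g ^ (n + 1)` of `(L² ∩ L^∞)(M)`. -/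
def power (n : ℕ) (g : L2Linf 𝕂 M) : L2Linf 𝕂 M := ofFun (isAdmissible_pow (n + 1) n.succ_ne_zero g)

theorem fn_power (n : ℕ) (g : L2Linf 𝕂 M) :
    L2Linf.fn (power n g) =ᵐ[volume] fun x => L2Linf.fn g x ^ (n + 1) := fn_ofFun _

theorem norm_pow_sub_pow_le {a b : ℂ} {R : ℝ} (ha : ‖a‖ ≤ R) (hb : ‖b‖ ≤ R) (n : ℕ) :
    ‖a ^ (n + 1) - b ^ (n + 1)‖ ≤ (n + 1) * R ^ n * ‖a - b‖ := by
  have hR : 0 ≤ R := (norm_nonneg a).trans ha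
  rw [← (Commute.all a b).geom_sum₂_mul, norm_mul]
  gcongr
  refine (norm_sum_le _ _).trans ?_
  have : ∀ i ∈ Finset.range (n + 1), ‖a ^ i * b ^ (n + 1 - 1 - i)‖ ≤ R ^ n := by
    intro i hi
    have hi' : i ≤ n := Nat.lt_succ_iff.1 (Finset.mem_range.1 hi)
    rw [norm_mul, norm_pow, norm_pow]
    calc ‖a‖ ^ i * ‖b‖ ^ (n + 1 - 1 - i) ≤ R ^ i * R ^ (n + 1 - 1 - i) := by gcongr
      _ = R ^ n := by rw [← pow_add]; congr 1; omega
  refine (Finset.sum_le_sum this).trans ?_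
  simp

theorem norm_power_sub_le (n : ℕ) {f g : L2Linf 𝕂 M} {R : ℝ} (hf : ‖f‖ ≤ R) (hg : ‖g‖ ≤ R) :
    ‖power n f - power n g‖ ≤ (n + 1) * R ^ n * ‖f - g‖ := by
  have hR : 0 ≤ R := (norm_nonneg f).trans hf
  refine norm_le_of_ae_le ?_ (by positivity)
  filter_upwards [fn_sub (power n f) (power n g), fn_sub f g, fn_power n f, fn_power n g,
    ae_norm_fn_le f, ae_norm_fn_le g] with x a b c d e e'
  rw [a, b, c, d]
  exact norm_pow_sub_pow_le (e.trans hf) (e'.trans hg) n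

theorem norm_power_le (n : ℕ) (f : L2Linf 𝕂 M) : ‖power n f‖ ≤ ‖f‖ ^ (n + 1) := by
  rw [pow_succ]
  refine norm_le_of_ae_le ?_ (by positivity)
  filter_upwards [fn_power n f, ae_norm_fn_le f] with x a b
  rw [a, norm_pow, pow_succ]
  gcongr

/-! ### Convolution with integrable kernels -/

theorem stronglyMeasurable_fn (g : L2Linf 𝕂 M) : StronglyMeasurable (L2Linf.fn g) :=
  Lp.stronglyMeasurable g.1.1

instance (M : SpatialDomain) : SFinite M.measure := by
  cases M
  · exact inferInstanceAs (SFinite (volume : Measure ℝ))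
  · exact inferInstanceAs (SFinite ((volume : Measure ℝ).restrict (Set.Ioc 0 1)))

/-- Changing the fundamental domain requires exact periodicity. The upper limit of `F (x + n)` is
periodic because a shift of the index does not change it, and it equals `F x` wherever all the `F (x
+ n)` agree with `F x`. -/
theorem exists_periodic_ae_eq {F : ℝ → ℝ≥0∞} (h : ∀ᵐ x : ℝ, F (x + 1) = F x) :
    ∃ F' : ℝ → ℝ≥0∞, F' =ᵐ[volume] F ∧ Function.Periodic F' 1 := by
  refine ⟨fun x => Filter.limsup (fun n : ℕ => F (x + n)) Filter.atTop, ?_, fun x => ?_⟩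
  · have h1 : ∀ n : ℕ, ∀ᵐ x : ℝ, F (x + n) = F x := by
      intro n
      induction n with
      | zero => simp
      | succ n ih =>
        have h2 := (measurePreserving_add_right (volume : Measure ℝ) n).quasiMeasurePreserving.ae h
        filter_upwards [ih, h2] with x a b
        rw [← a, ← b]
        push_cast
        ring_nf
    filter_upwards [ae_all_iff.2 h1] with x hx
    simp [hx]
  · have := Filter.limsup_nat_add (fun n : ℕ => F (x + n)) 1
    simp only [← this]
    push_cast
    ring_nf

theorem lintegral_translate (g : L2Linf 𝕂 M) (y : ℝ) :
    ∫⁻ x, ‖L2Linf.fn g (x - y)‖ₑ ^ 2 ∂M.measure = ∫⁻ x, ‖L2Linf.fn g x‖ₑ ^ 2 ∂M.measure := by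
  have hp := (isAdmissible_fn g).ae_periodic
  cases M with
  | line =>
    exact lintegral_sub_right_eq_self (μ := (volume : Measure ℝ)) (fun x => ‖L2Linf.fn g x‖ₑ ^ 2) y
  | torus =>
    obtain ⟨F, hF, hper⟩ := exists_periodic_ae_eq (F := fun x => ‖L2Linf.fn g x‖ₑ ^ 2) (by
      filter_upwards [hp rfl] with x hx
      rw [hx])
    have hF' := (measurePreserving_sub_right (volume : Measure ℝ) y).quasiMeasurePreserving.ae hF
    change ∫⁻ x in Set.Ioc 0 1, _ = ∫⁻ x in Set.Ioc 0 1, _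
    rw [← lintegral_congr_ae (ae_restrict_of_ae hF), ← lintegral_congr_ae (ae_restrict_of_ae hF')]
    have h1 : ∫⁻ x in Set.Ioc 0 1, F (x - y) = ∫⁻ x in Set.Ioc (-y) (-y + 1), F x := by
      rw [← (measurePreserving_sub_right volume y).setLIntegral_comp_preimage_emb
        (measurableEmbedding_subRight y) F (Set.Ioc (-y) (-y + 1))]
      congr 2
      ext x
      simp only [Set.mem_Ioc, Set.mem_preimage]
      constructor <;> rintro ⟨a, b⟩ <;> constructor <;> linarith
    have h2 := (isAddFundamentalDomain_Ioc (zero_lt_one' ℝ) (-y) volume).setLIntegral_eq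
      (isAddFundamentalDomain_Ioc (zero_lt_one' ℝ) 0 volume) F (by
        rintro ⟨z, hz⟩ x
        obtain ⟨n, rfl⟩ := AddSubgroup.mem_zmultiples_iff.1 hz
        change F (n • 1 + x) = F x
        rw [add_comm]
        exact hper.zsmul n x)
    rw [h1, h2, zero_add]

/-- Cauchy–Schwarz for the splitting `a b = a^(1/2) · (a^(1/2) b)`. -/
theorem lintegral_mul_sq_le {a b : ℝ → ℝ≥0∞} (ha : AEMeasurable a) (hb : AEMeasurable b) :
    (∫⁻ y, a y * b y) ^ 2 ≤ (∫⁻ y, a y) * ∫⁻ y, a y * b y ^ 2 := by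
  have h := ENNReal.lintegral_mul_le_Lp_mul_Lq (volume : Measure ℝ)
    (Real.HolderConjugate.two_two) (ha.pow_const (1 / 2 : ℝ))
    ((ha.pow_const (1 / 2 : ℝ)).mul hb)
  have h3 : ∀ x : ℝ≥0∞, x ^ (1 / 2 : ℝ) * x ^ (1 / 2 : ℝ) = x := fun x => by
    rw [← ENNReal.rpow_add_of_nonneg _ _ (by norm_num) (by norm_num)]
    norm_num
  have h4 : ∀ x : ℝ≥0∞, (x ^ (1 / 2 : ℝ)) ^ 2 = x := fun x => by rw [pow_two, h3]
  simp only [Pi.mul_apply, ENNReal.rpow_two, mul_pow, h4, ← mul_assoc, h3] at h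
  calc (∫⁻ y, a y * b y) ^ 2 ≤ _ := pow_le_pow_left' h 2
    _ = _ := by rw [mul_pow, h4, h4]

theorem ae_sub_left {p : ℝ → Prop} (x : ℝ) (h : ∀ᵐ y : ℝ, p y) : ∀ᵐ y : ℝ, p (x - y) :=
  (Measure.measurePreserving_sub_left volume x).quasiMeasurePreserving.ae h

/-- The convolution of a real kernel with a complex function. -/
def convFun (K : ℝ → ℝ) (f : ℝ → ℂ) (x : ℝ) : ℂ := ∫ y, (K y : ℂ) * f (x - y)

theorem convFun_congr {K : ℝ → ℝ} {f g : ℝ → ℂ} (h : f =ᵐ[volume] g) : convFun K f = convFun K g := by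
  funext x
  refine integral_congr_ae ?_
  filter_upwards [ae_sub_left x h] with y hy
  rw [hy]

variable {K : ℝ → ℝ}

theorem integrable_convFun (hK : Integrable K) (g : L2Linf 𝕂 M) (x : ℝ) :
    Integrable fun y => (K y : ℂ) * L2Linf.fn g (x - y) := by
  refine hK.ofReal.mul_bdd (c := ‖g‖) ?_ ?_
  · exact ((stronglyMeasurable_fn g).comp_measurable
      (measurable_const.sub measurable_id)).aestronglyMeasurable
  · exact ae_sub_left x (ae_norm_fn_le g)

theorem aestronglyMeasurable_convFun (hK : Integrable K) (g : L2Linf 𝕂 M) (μ : Measure ℝ) :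
    AEStronglyMeasurable (convFun K (L2Linf.fn g)) μ := by
  have h : StronglyMeasurable (convFun (hK.1.mk K) (L2Linf.fn g)) := by
    refine StronglyMeasurable.integral_prod_right
      (f := fun x y => ((hK.1.mk K y : ℝ) : ℂ) * L2Linf.fn g (x - y)) ?_
    exact (Complex.continuous_ofReal.comp_stronglyMeasurable
      (hK.1.stronglyMeasurable_mk.comp_measurable measurable_snd)).mul
      ((stronglyMeasurable_fn g).comp_measurable (measurable_fst.sub measurable_snd))
  have h2 : convFun K (L2Linf.fn g) = convFun (hK.1.mk K) (L2Linf.fn g) := by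
    funext x
    refine integral_congr_ae ?_
    filter_upwards [hK.1.ae_eq_mk] with y hy
    rw [hy]
  rw [h2]
  exact h.aestronglyMeasurable

theorem norm_convFun_le (hK : Integrable K) (g : L2Linf 𝕂 M) (x : ℝ) :
    ‖convFun K (L2Linf.fn g) x‖ ≤ (∫ y, |K y|) * ‖g‖ := by
  rw [← integral_mul_const]
  refine norm_integral_le_of_norm_le (hK.abs.mul_const _) ?_
  filter_upwards [ae_sub_left x (ae_norm_fn_le g)] with y hy
  rw [norm_mul, Complex.norm_real, Real.norm_eq_abs]
  gcongr

/-- Young's inequality `L¹ * L² ⊂ L²`, by Cauchy–Schwarz with weight `|K|`, Tonelli and translation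
invariance. The kernel lives on the real line even for the torus, where only `x` is restricted to a
period. -/
theorem lintegral_convFun_sq_le (hK : Integrable K) (g : L2Linf 𝕂 M) :
    ∫⁻ x, ‖convFun K (L2Linf.fn g) x‖ₑ ^ 2 ∂M.measure ≤
      ENNReal.ofReal ((∫ y, |K y|) * ‖g‖) ^ 2 := by
  have hKm : AEMeasurable fun y => ‖K y‖ₑ := hK.1.enorm
  have hgm : Measurable fun y => ‖L2Linf.fn g y‖ₑ := (stronglyMeasurable_fn g).enorm
  have hI : ∫⁻ y, ‖K y‖ₑ = ENNReal.ofReal (∫ y, |K y|) := by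
    rw [ofReal_integral_eq_lintegral_ofReal hK.abs (ae_of_all _ fun _ => abs_nonneg _)]
    simp [Real.enorm_eq_ofReal_abs]
  have h1 : ∀ x, ‖convFun K (L2Linf.fn g) x‖ₑ ^ 2 ≤
      (∫⁻ y, ‖K y‖ₑ) * ∫⁻ y, ‖K y‖ₑ * ‖L2Linf.fn g (x - y)‖ₑ ^ 2 := by
    intro x
    refine (pow_le_pow_left' ((enorm_integral_le_lintegral_enorm _).trans_eq ?_) 2).trans
      (lintegral_mul_sq_le hKm
        (hgm.comp (measurable_const.sub measurable_id : Measurable fun y => x - y)).aemeasurable)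
    refine lintegral_congr fun y => ?_
    rw [enorm_mul, ← ofReal_norm, Complex.norm_real, ofReal_norm]
  calc ∫⁻ x, ‖convFun K (L2Linf.fn g) x‖ₑ ^ 2 ∂M.measure
      ≤ ∫⁻ x, ((∫⁻ y, ‖K y‖ₑ) * ∫⁻ y, ‖K y‖ₑ * ‖L2Linf.fn g (x - y)‖ₑ ^ 2) ∂M.measure :=
        lintegral_mono h1
    _ = (∫⁻ y, ‖K y‖ₑ) * ∫⁻ x, (∫⁻ y, ‖K y‖ₑ * ‖L2Linf.fn g (x - y)‖ₑ ^ 2) ∂M.measure := by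
        rw [lintegral_const_mul' _ _ (by rw [hI]; exact ENNReal.ofReal_ne_top)]
    _ = (∫⁻ y, ‖K y‖ₑ) * ∫⁻ y, ‖K y‖ₑ * ∫⁻ x, ‖L2Linf.fn g x‖ₑ ^ 2 ∂M.measure := by
        have hm : AEMeasurable (Function.uncurry fun x y => ‖K y‖ₑ * ‖L2Linf.fn g (x - y)‖ₑ ^ 2)
            (M.measure.prod volume) :=
          hKm.comp_snd.mul ((hgm.comp (measurable_fst.sub measurable_snd)).pow_const 2).aemeasurable
        rw [lintegral_lintegral_swap hm]
        simp_rw [lintegral_const_mul' _ _ enorm_ne_top, lintegral_translate]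
    _ ≤ (∫⁻ y, ‖K y‖ₑ) * ∫⁻ y, ‖K y‖ₑ * ENNReal.ofReal ‖g‖ ^ 2 := by
        gcongr
        exact lintegral_fn_sq_le g
    _ = ENNReal.ofReal ((∫ y, |K y|) * ‖g‖) ^ 2 := by
        rw [lintegral_mul_const'' _ hKm, hI, ENNReal.ofReal_mul
          (integral_nonneg fun y => abs_nonneg (K y))]
        ring

/-- The orthogonal projection onto `𝕂` is real-linear and continuous, so it commutes with the
integral. -/
theorem integral_mem_subalgebra {f : ℝ → ℂ} (hf : Integrable f) (h : ∀ᵐ x, f x ∈ 𝕂) :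
    ∫ x, f x ∈ 𝕂 := by
  let S : Submodule ℝ ℂ := Subalgebra.toSubmodule 𝕂
  have h1 : S.starProjection (∫ x, f x) = ∫ x, f x := by
    rw [← ContinuousLinearMap.integral_comp_comm _ hf]
    refine integral_congr_ae ?_
    filter_upwards [h] with x hx
    exact Submodule.starProjection_eq_self_iff.2 hx
  exact Submodule.starProjection_eq_self_iff.1 h1

theorem isAdmissible_convFun (hK : Integrable K) (g : L2Linf 𝕂 M) :
    IsAdmissible 𝕂 M (convFun K (L2Linf.fn g)) where
  memLp_top := memLp_top_of_bound (aestronglyMeasurable_convFun hK g _) _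
    (ae_of_all _ (norm_convFun_le hK g))
  memLp_two := (memLp_two_of_lintegral (aestronglyMeasurable_convFun hK g _)
    (lintegral_convFun_sq_le hK g)).1
  ae_mem := ae_of_all _ fun x => by
    refine integral_mem_subalgebra (integrable_convFun hK g x) ?_
    filter_upwards [ae_sub_left x (isAdmissible_fn g).ae_mem] with y hy
    rw [← Complex.real_smul]
    exact 𝕂.smul_mem hy _
  ae_periodic hM := ae_of_all _ fun x => by
    refine integral_congr_ae ?_
    filter_upwards [ae_sub_left x ((isAdmissible_fn g).ae_periodic hM)] with y hy
    rw [← hy]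
    ring_nf

/-- The convolution operator of `(L² ∩ L^∞)(M)` defined by an integrable kernel. -/
def convLin (hK : Integrable K) : L2Linf 𝕂 M →ₗ[ℝ] L2Linf 𝕂 M where
  toFun g := ofFun (isAdmissible_convFun hK g)
  map_add' f g := by
    apply ext_fn
    have h := fn_ofFun (isAdmissible_convFun hK (f + g))
    filter_upwards [h, fn_add (ofFun (isAdmissible_convFun hK f))
      (ofFun (isAdmissible_convFun hK g)), fn_ofFun (isAdmissible_convFun hK f),
      fn_ofFun (isAdmissible_convFun hK g)] with x a b c d
    rw [a, b, c, d, convFun_congr (fn_add f g)]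
    simp only [convFun, mul_add]
    exact integral_add (integrable_convFun hK f x) (integrable_convFun hK g x)
  map_smul' r f := by
    apply ext_fn
    filter_upwards [fn_ofFun (isAdmissible_convFun hK (r • f)),
      fn_smul r (ofFun (isAdmissible_convFun hK f)),
      fn_ofFun (isAdmissible_convFun hK f)] with x a b c
    rw [a, RingHom.id_apply, b, c, convFun_congr (fn_smul r f)]
    simp only [convFun]
    rw [← integral_const_mul]
    congr 1
    ext y
    ring

theorem fn_convLin (hK : Integrable K) (g : L2Linf 𝕂 M) :
    L2Linf.fn (convLin hK g) =ᵐ[volume] convFun K (L2Linf.fn g) :=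
  fn_ofFun (isAdmissible_convFun hK g)

theorem norm_convLin_le (hK : Integrable K) (g : L2Linf 𝕂 M) :
    ‖convLin hK g‖ ≤ (∫ y, |K y|) * ‖g‖ :=
  norm_ofFun_le (isAdmissible_convFun hK g) (mul_nonneg (integral_nonneg fun _ => abs_nonneg _)
      (norm_nonneg _)) (ae_of_all _ (norm_convFun_le hK g)) (lintegral_convFun_sq_le hK g)

/-- By Fubini the convolution is transferred to the test function, where it becomes a correlation
with `K`. The hypothesis says that this correlation is again a Schwartz function, so that an
operator on distributions is identified by its action on test functions alone. -/
theorem toDist_convLin (hK : Integrable K) (g : L2Linf 𝕂 M) {ψ χ : 𝓢(ℝ, ℂ)}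
    (h : ∀ x, ∫ y, (K y : ℂ) * ψ (x + y) = χ x) :
    L2Linf.toDist (convLin hK g) ψ = L2Linf.toDist g χ := by
  have hgm := stronglyMeasurable_fn g
  have h0 : Integrable (Function.uncurry fun x y : ℝ => ψ x * ((K y : ℂ) * L2Linf.fn g (x - y)))
      (volume.prod volume) := by
    have h1 : Integrable (fun p : ℝ × ℝ => (ψ p.1 * (K p.2 : ℂ)) * L2Linf.fn g (p.1 - p.2))
        (volume.prod volume) := by
      refine (ψ.integrable.mul_prod hK.ofReal).mul_bdd (c := ‖g‖) ?_ ?_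
      · exact (hgm.comp_measurable (measurable_fst.sub measurable_snd)).aestronglyMeasurable
      · exact (quasiMeasurePreserving_sub volume volume).ae (ae_norm_fn_le g)
    refine h1.congr (ae_of_all _ fun p => ?_)
    simp only [Function.uncurry]
    ring
  have h0' : Integrable (Function.uncurry fun x y : ℝ => L2Linf.fn g x * ((K y : ℂ) * ψ (x + y)))
      (volume.prod volume) := by
    -- The shear `(x, y) ↦ (x + y, y)` preserves the measure and carries the first integrand to the
    -- second.
    have h2 := (measurePreserving_add_prod (volume : Measure ℝ) volume).integrable_comp_of_integrable h0
    refine h2.congr (ae_of_all _ fun p => ?_)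
    simp only [Function.uncurry, Function.comp_apply, add_sub_cancel_right]
    ring
  rw [L2Linf.toDist_apply, L2Linf.toDist_apply]
  calc ∫ x, ψ x * L2Linf.fn (convLin hK g) x
      = ∫ x, ∫ y, ψ x * ((K y : ℂ) * L2Linf.fn g (x - y)) := by
        refine integral_congr_ae ?_
        filter_upwards [fn_convLin hK g] with x hx
        rw [hx, convFun, integral_const_mul]
    _ = ∫ y, ∫ x, ψ x * ((K y : ℂ) * L2Linf.fn g (x - y)) := integral_integral_swap h0
    _ = ∫ y, ∫ x, L2Linf.fn g x * ((K y : ℂ) * ψ (x + y)) := by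
        congr 1
        ext y
        rw [← integral_add_right_eq_self _ y]
        congr 1
        ext x
        rw [add_sub_cancel_right]
        ring
    _ = ∫ x, ∫ y, L2Linf.fn g x * ((K y : ℂ) * ψ (x + y)) := (integral_integral_swap h0').symm
    _ = _ := by
        congr 1
        ext x
        rw [integral_const_mul, h, mul_comm]

/-! ### The Bessel kernel and the operator `⟨∇⟩^s` -/

/-- The integrand of the subordination formula for the Bessel kernel of order `2 β`. -/
def besselIntegrand (β : ℝ) (t y : ℝ) : ℝ :=
  Real.exp (-t) * t ^ (β - 1) * (√(Real.pi / t) * Real.exp (-(Real.pi ^ 2 / t) * y ^ 2))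

theorem integral_heat {t : ℝ} (ht : 0 < t) :
    ∫ y : ℝ, √(Real.pi / t) * Real.exp (-(Real.pi ^ 2 / t) * y ^ 2) = 1 := by
  rw [integral_const_mul, integral_gaussian, ← Real.sqrt_mul (by positivity)]
  rw [show Real.pi / t * (Real.pi / (Real.pi ^ 2 / t)) = 1 by field_simp]
  simp

theorem fourier_heat {t : ℝ} (ht : 0 < t) (ξ : ℝ) :
    ∫ y : ℝ, Complex.exp (↑(-2 * Real.pi * y * ξ) * Complex.I) *
      ((√(Real.pi / t) * Real.exp (-(Real.pi ^ 2 / t) * y ^ 2) : ℝ) : ℂ) = Real.exp (-(ξ ^ 2 * t)) := by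
  have hb : 0 < ((Real.pi ^ 2 / t : ℝ) : ℂ).re := by
    rw [Complex.ofReal_re]
    positivity
  have h := fourierIntegral_gaussian hb ((-2 * Real.pi * ξ : ℝ) : ℂ)
  have h1 : (((Real.pi : ℂ) / ((Real.pi ^ 2 / t : ℝ) : ℂ)) ^ (1 / 2 : ℂ)) =
      ((√(Real.pi / (Real.pi ^ 2 / t)) : ℝ) : ℂ) := by
    rw [Real.sqrt_eq_rpow, Complex.ofReal_cpow (by positivity)]
    push_cast
    ring_nf
  have h2 : -((-2 * Real.pi * ξ : ℝ) : ℂ) ^ 2 / (4 * ((Real.pi ^ 2 / t : ℝ) : ℂ)) =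
      ((-(ξ ^ 2 * t) : ℝ) : ℂ) := by
    have h3 : -(ξ ^ 2 * t) = -(-2 * Real.pi * ξ) ^ 2 / (4 * (Real.pi ^ 2 / t)) := by
      have := Real.pi_ne_zero
      field_simp
      ring
    rw [h3]
    push_cast
    ring
  rw [h1, h2] at h
  calc _ = ∫ y : ℝ, ((√(Real.pi / t) : ℝ) : ℂ) *
        (Complex.exp (Complex.I * ((-2 * Real.pi * ξ : ℝ) : ℂ) * y) *
          Complex.exp (-((Real.pi ^ 2 / t : ℝ) : ℂ) * y ^ 2)) := by
        congr 1
        ext y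
        push_cast
        ring_nf
    _ = ((√(Real.pi / t) * √(Real.pi / (Real.pi ^ 2 / t)) : ℝ) : ℂ) * Real.exp (-(ξ ^ 2 * t)) := by
        rw [integral_const_mul, h]
        push_cast
        ring
    _ = _ := by
        rw [← Real.sqrt_mul (by positivity),
          show Real.pi / t * (Real.pi / (Real.pi ^ 2 / t)) = 1 by field_simp]
        simp

theorem besselIntegrand_nonneg (β : ℝ) {t : ℝ} (ht : 0 < t) (y : ℝ) : 0 ≤ besselIntegrand β t y := by
  unfold besselIntegrand
  positivity

/-- The Gaussian factor has total mass one, so integrating in `y` first leaves the Gamma integral of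
order `β`. -/
theorem integrable_besselIntegrand {β : ℝ} (hβ : 0 < β) :
    Integrable (Function.uncurry (besselIntegrand β))
      ((volume.restrict (Set.Ioi (0 : ℝ))).prod volume) := by
  have hm : Measurable (Function.uncurry (besselIntegrand β)) := by
    unfold besselIntegrand Function.uncurry
    fun_prop
  rw [integrable_prod_iff hm.aestronglyMeasurable]
  have h0 : ∀ᵐ t ∂(volume.restrict (Set.Ioi (0 : ℝ))), 0 < t := ae_restrict_mem measurableSet_Ioi
  constructor
  · filter_upwards [h0] with t ht
    simp only [Function.uncurry, besselIntegrand]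
    exact ((integrable_exp_neg_mul_sq (b := Real.pi ^ 2 / t) (by positivity)).const_mul _).const_mul _
  · refine (Real.GammaIntegral_convergent hβ).congr ?_
    filter_upwards [h0] with t ht
    simp only [Function.uncurry, Real.norm_of_nonneg (besselIntegrand_nonneg β ht _)]
    simp only [besselIntegrand]
    rw [integral_const_mul, integral_heat ht, mul_one]

/-- The Bessel kernel, whose Fourier transform is `(1 + ξ²) ^ (-β)`. -/
def besselKernel (β : ℝ) (y : ℝ) : ℝ :=
  (Real.Gamma β)⁻¹ * ∫ t in Set.Ioi (0 : ℝ), besselIntegrand β t y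

theorem integrable_besselKernel {β : ℝ} (hβ : 0 < β) : Integrable (besselKernel β) :=
  (integrable_besselIntegrand hβ).integral_prod_right.const_mul _

/-- Subordination: the Gaussian factor has Fourier transform `exp (-t ξ²)`, and `Γ(β) (1 + ξ²)^(-β)`
is the integral of `t^(β-1) exp (-(1 + ξ²) t)` over `t > 0`. -/
theorem fourier_besselKernel {β : ℝ} (hβ : 0 < β) (ξ : ℝ) :
    ∫ y : ℝ, Complex.exp (↑(-2 * Real.pi * y * ξ) * Complex.I) * (besselKernel β y : ℂ) =
      (((1 + ξ ^ 2) ^ (-β) : ℝ) : ℂ) := by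
  have hint : Integrable (Function.uncurry fun t y : ℝ =>
      Complex.exp (↑(-2 * Real.pi * y * ξ) * Complex.I) * (besselIntegrand β t y : ℂ))
      ((volume.restrict (Set.Ioi (0 : ℝ))).prod volume) := by
    refine (integrable_besselIntegrand hβ).ofReal.bdd_mul (c := 1) ?_ ?_
    · exact Continuous.aestronglyMeasurable (by fun_prop)
    · exact ae_of_all _ fun p => by
        rw [Complex.norm_exp_ofReal_mul_I]
  calc _ = ∫ y : ℝ, ((Real.Gamma β)⁻¹ : ℂ) * ∫ t in Set.Ioi (0 : ℝ),
        Complex.exp (↑(-2 * Real.pi * y * ξ) * Complex.I) * (besselIntegrand β t y : ℂ) := by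
        congr 1
        ext y
        rw [integral_const_mul, integral_complex_ofReal, besselKernel]
        push_cast
        ring
    _ = ((Real.Gamma β)⁻¹ : ℂ) * ∫ t in Set.Ioi (0 : ℝ), ∫ y : ℝ,
        Complex.exp (↑(-2 * Real.pi * y * ξ) * Complex.I) * (besselIntegrand β t y : ℂ) := by
        rw [integral_const_mul, integral_integral_swap hint]
    _ = ((Real.Gamma β)⁻¹ : ℂ) * ∫ t in Set.Ioi (0 : ℝ),
        ((t ^ (β - 1) * Real.exp (-((1 + ξ ^ 2) * t)) : ℝ) : ℂ) := by
        congr 1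
        refine setIntegral_congr_fun measurableSet_Ioi fun t ht => ?_
        have : ∀ y : ℝ, Complex.exp (↑(-2 * Real.pi * y * ξ) * Complex.I) *
            (besselIntegrand β t y : ℂ) = ((Real.exp (-t) * t ^ (β - 1) : ℝ) : ℂ) *
            (Complex.exp (↑(-2 * Real.pi * y * ξ) * Complex.I) *
      ((√(Real.pi / t) * Real.exp (-(Real.pi ^ 2 / t) * y ^ 2) : ℝ) : ℂ)) := fun y => by
          rw [besselIntegrand, Complex.ofReal_mul (Real.exp (-t) * t ^ (β - 1))]
          ring
        simp only [this]
        rw [integral_const_mul, fourier_heat ht, ← Complex.ofReal_mul]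
        congr 1
        rw [show -((1 + ξ ^ 2) * t) = -t + -(ξ ^ 2 * t) by ring, Real.exp_add]
        ring
    _ = _ := by
        rw [integral_complex_ofReal, Real.integral_rpow_mul_exp_neg_mul_Ioi hβ (by positivity)]
        have := (Real.Gamma_pos_of_pos hβ).ne'
        rw [← Complex.ofReal_inv, ← Complex.ofReal_mul]
        congr 1
        rw [one_div, Real.inv_rpow (by positivity), Real.rpow_neg (by positivity)]
        field_simp

open FourierTransform in
-- Links the explicit kernel with the Fourier multiplier that defines `besselPotential`: expand `ψ`
-- by Fourier inversion and exchange the integrals.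
theorem integral_besselKernel_mul {β : ℝ} (hβ : 0 < β) (ψ : 𝓢(ℝ, ℂ)) (x : ℝ) :
    ∫ y, (besselKernel β y : ℂ) * ψ (x + y) =
      (𝓕 (SchwartzMap.smulLeftCLM ℂ (fun ξ : ℝ => (((1 + ‖ξ‖ ^ 2) ^ (-β) : ℝ) : ℂ)) (𝓕⁻ ψ)) :
        𝓢(ℝ, ℂ)) x := by
  have hint : Integrable (Function.uncurry fun y ξ : ℝ =>
      Complex.exp (↑(-2 * Real.pi * ξ * (x + y)) * Complex.I) *
        ((besselKernel β y : ℂ) * (𝓕⁻ ψ) ξ)) (volume.prod volume) := by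
    refine Integrable.bdd_mul (c := 1) ?_ ?_ ?_
    · exact (integrable_besselKernel hβ).ofReal.mul_prod (𝓕⁻ ψ).integrable
    · exact Continuous.aestronglyMeasurable (by fun_prop)
    · exact ae_of_all _ fun p => by
        rw [Complex.norm_exp_ofReal_mul_I]
  have hψ : ∀ z, ψ z = ∫ ξ : ℝ, Complex.exp (↑(-2 * Real.pi * ξ * z) * Complex.I) * (𝓕⁻ ψ) ξ := by
    intro z
    conv_lhs => rw [← fourier_fourierInv_eq (E := 𝓢(ℝ, ℂ)) (F := 𝓢(ℝ, ℂ)) ψ]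
    rw [SchwartzMap.fourier_coe, Real.fourier_real_eq_integral_exp_smul]
    rfl
  calc _ = ∫ y, ∫ ξ : ℝ, Complex.exp (↑(-2 * Real.pi * ξ * (x + y)) * Complex.I) *
        ((besselKernel β y : ℂ) * (𝓕⁻ ψ) ξ) := by
        congr 1
        ext y
        rw [hψ, ← integral_const_mul]
        congr 1
        ext ξ
        ring
    _ = ∫ ξ : ℝ, ∫ y, Complex.exp (↑(-2 * Real.pi * ξ * (x + y)) * Complex.I) *
        ((besselKernel β y : ℂ) * (𝓕⁻ ψ) ξ) := integral_integral_swap hint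
    _ = ∫ ξ : ℝ, Complex.exp (↑(-2 * Real.pi * ξ * x) * Complex.I) *
        ((((1 + ‖ξ‖ ^ 2) ^ (-β) : ℝ) : ℂ) * (𝓕⁻ ψ) ξ) := by
        congr 1
        ext ξ
        have : ∀ y, Complex.exp (↑(-2 * Real.pi * ξ * (x + y)) * Complex.I) *
            ((besselKernel β y : ℂ) * (𝓕⁻ ψ) ξ) =
            (Complex.exp (↑(-2 * Real.pi * ξ * x) * Complex.I) * (𝓕⁻ ψ) ξ) *
            (Complex.exp (↑(-2 * Real.pi * y * ξ) * Complex.I) * (besselKernel β y : ℂ)) := by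
          intro y
          rw [show (↑(-2 * Real.pi * ξ * (x + y)) * Complex.I : ℂ) =
            ↑(-2 * Real.pi * ξ * x) * Complex.I + ↑(-2 * Real.pi * y * ξ) * Complex.I by
              push_cast; ring, Complex.exp_add]
          ring
        simp only [this]
        rw [integral_const_mul, fourier_besselKernel hβ, Real.norm_eq_abs, sq_abs]
        ring
    _ = _ := by
        rw [SchwartzMap.fourier_coe, Real.fourier_real_eq_integral_exp_smul]
        congr 1
        ext ξ
        rw [SchwartzMap.smulLeftCLM_apply_apply (by fun_prop)]
        rfl

/-- The operator `⟨∇⟩^s` on `(L² ∩ L^∞)(M)`, for `s < 0`. -/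
def besselOp (hs : s < 0) : L2Linf 𝕂 M →ₗ[ℝ] L2Linf 𝕂 M :=
  convLin (integrable_besselKernel (β := -s / 2) (by linarith))

theorem toDist_besselOp (hs : s < 0) (g : L2Linf 𝕂 M) :
    L2Linf.toDist (besselOp hs g) = besselPotential ℝ ℂ s (L2Linf.toDist g) := by
  ext ψ
  have h := toDist_convLin (integrable_besselKernel (β := -s / 2) (by linarith)) g
    (integral_besselKernel_mul (β := -s / 2) (by linarith) ψ)
  rw [besselOp, h, besselPotential, fourierMultiplierCLM_apply_apply]
  rw [show - (-s / 2) = s / 2 by ring]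

/-! ### Embedding in `W^{s,2,∞}(M)` and testing against Schwartz functions -/

/-- The inclusion of `(L² ∩ L^∞)(M)` in `W^{s,2,∞}(M)`, for `s < 0`. -/
def inclusion (hs : s < 0) : L2Linf 𝕂 M →ₗ[ℝ] W 𝕂 M s := W.bessel.symm.toLinearMap ∘ₗ besselOp hs

theorem toDist_inclusion (hs : s < 0) (g : L2Linf 𝕂 M) :
    (inclusion hs g).toDist = L2Linf.toDist g := by
  have h := W.toDist_bessel (inclusion hs g)
  have h1 : W.bessel (inclusion hs g) = besselOp hs g := LinearEquiv.apply_symm_apply _ _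
  rw [h1, toDist_besselOp] at h
  have h' := congrArg (besselPotential ℝ ℂ (-s)) h
  simpa only [besselPotential_besselPotential_apply, add_neg_cancel, besselPotential_zero,
    ContinuousLinearMap.id_apply] using h'.symm

theorem norm_inclusion (hs : s < 0) (g : L2Linf 𝕂 M) : ‖inclusion hs g‖ = ‖besselOp hs g‖ := by
  rw [W.norm_def]
  congr 1
  exact LinearEquiv.apply_symm_apply _ _

theorem W.toDist_injective : Function.Injective (W.toDist : W 𝕂 M s →ₗ[ℝ] 𝓢'(ℝ, ℂ)) :=
  Subtype.val_injective

theorem norm_toDist_apply_le (g : L2Linf 𝕂 M) (ψ : 𝓢(ℝ, ℂ)) :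
    ‖L2Linf.toDist g ψ‖ ≤ (∫ x, ‖ψ x‖) * ‖g‖ := by
  rw [L2Linf.toDist_apply, ← integral_mul_const]
  refine norm_integral_le_of_norm_le (ψ.integrable.norm.mul_const _) ?_
  filter_upwards [ae_norm_fn_le g] with x hx
  rw [norm_mul]
  gcongr

/-- The operator `⟨∇⟩^(-s)` is moved onto the test function, which remains Schwartz, hence
integrable. This turns bounds in `W^{s,2,∞}` into bounds on pairings. -/
theorem W.exists_norm_toDist_apply_le (ψ : 𝓢(ℝ, ℂ)) :
    ∃ C, 0 ≤ C ∧ ∀ f : W 𝕂 M s, ‖f.toDist ψ‖ ≤ C * ‖f‖ := by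
  let φ : 𝓢(ℝ, ℂ) := FourierTransform.fourier (SchwartzMap.smulLeftCLM ℂ
    (fun ξ : ℝ => (((1 + ‖ξ‖ ^ 2) ^ (-s / 2) : ℝ) : ℂ)) (FourierTransform.fourierInv ψ))
  refine ⟨∫ x, ‖φ x‖, integral_nonneg fun x => norm_nonneg _, fun f => ?_⟩
  · have h : f.toDist = besselPotential ℝ ℂ (-s) (L2Linf.toDist (W.bessel f)) := by
      rw [W.toDist_bessel, besselPotential_besselPotential_apply, add_neg_cancel,
        besselPotential_zero, ContinuousLinearMap.id_apply]
    rw [h, W.norm_def, besselPotential, fourierMultiplierCLM_apply_apply]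
    exact norm_toDist_apply_le _ _

/-! ### The Green kernel of `1 - ∂²` -/

/-- The fundamental solution of `1 - ∂²`. -/
def greenKernel (y : ℝ) : ℝ := Real.exp (-|y|) / 2

theorem integrable_greenKernel : Integrable greenKernel := by
  refine Integrable.div_const ?_ 2
  rw [← integrableOn_univ, ← Set.Iic_union_Ioi (a := (0 : ℝ)), integrableOn_union]
  constructor
  · refine (integrableOn_exp_Iic 0).congr_fun (fun x hx => ?_) measurableSet_Iic
    rw [abs_of_nonpos hx, neg_neg]
  · refine (exp_neg_integrableOn_Ioi 0 one_pos).congr_fun (fun x hx => ?_) measurableSet_Ioi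
    simp [abs_of_pos (Set.mem_Ioi.1 hx)]

/-- The second derivative of a Schwartz function. -/
def secondDeriv (ψ : 𝓢(ℝ, ℂ)) : 𝓢(ℝ, ℂ) :=
  SchwartzMap.derivCLM ℂ ℂ (SchwartzMap.derivCLM ℂ ℂ ψ)

theorem secondDeriv_apply (ψ : 𝓢(ℝ, ℂ)) (x : ℝ) : secondDeriv ψ x = deriv (deriv ψ) x := by
  rw [secondDeriv, SchwartzMap.derivCLM_apply]
  congr 1

/-- Both half-line integrands have explicit primitives, `-exp (-y) (ψ + ψ') / 2` for `y > 0` and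
`exp y (ψ - ψ') / 2` for `y < 0`, evaluated at `x + y`. They vanish at infinity, and the boundary
terms at `y = 0` add up to `ψ x`. -/
theorem integral_greenKernel_mul (ψ : 𝓢(ℝ, ℂ)) (x : ℝ) :
    ∫ y, (greenKernel y : ℂ) * (ψ - secondDeriv ψ) (x + y) = ψ x := by
  set ψ' := SchwartzMap.derivCLM ℂ ℂ ψ with hψ'
  have hd : ∀ y, HasDerivAt ψ (ψ' y) y := fun y => by
    rw [hψ', SchwartzMap.derivCLM_apply]
    exact ψ.differentiableAt.hasDerivAt
  have hd' : ∀ y, HasDerivAt ψ' (secondDeriv ψ y) y := fun y => by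
    rw [secondDeriv, SchwartzMap.derivCLM_apply]
    exact ψ'.differentiableAt.hasDerivAt
  have hint : Integrable fun y => (greenKernel y : ℂ) * (ψ - secondDeriv ψ) (x + y) := by
    refine Integrable.bdd_mul (c := 1) ?_ ?_ ?_
    · exact (ψ - secondDeriv ψ).integrable.comp_add_left x
    · exact integrable_greenKernel.ofReal.1
    · refine ae_of_all _ fun y => ?_
      rw [Complex.norm_real, greenKernel, Real.norm_of_nonneg (by positivity)]
      have : Real.exp (-|y|) ≤ 1 := Real.exp_le_one_iff.2 (by simp)
      linarith
  have htop : ∀ φ : 𝓢(ℝ, ℂ), Filter.Tendsto (fun y : ℝ => φ (x + y)) Filter.atTop (nhds 0) :=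
    fun φ => by
      have := (φ.toZeroAtInfty.zero_at_infty').mono_left
        (_root_.atTop_le_cocompact)
      exact this.comp (Filter.tendsto_atTop_add_const_left _ _ Filter.tendsto_id)
  have hbot : ∀ φ : 𝓢(ℝ, ℂ), Filter.Tendsto (fun y : ℝ => φ (x + y)) Filter.atBot (nhds 0) :=
    fun φ => by
      have := (φ.toZeroAtInfty.zero_at_infty').mono_left
        (_root_.atBot_le_cocompact)
      exact this.comp (Filter.tendsto_atBot_add_const_left _ _ Filter.tendsto_id)
  have hshift : ∀ (φ φ' : ℝ → ℂ) (y : ℝ), (∀ z, HasDerivAt φ (φ' z) z) →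
      HasDerivAt (fun y => φ (x + y)) (φ' (x + y)) y := fun φ φ' y h =>
    (h (x + y)).comp_const_add x y
  have h1 : ∫ y in Set.Ioi (0 : ℝ), (greenKernel y : ℂ) * (ψ - secondDeriv ψ) (x + y) =
      (ψ x + ψ' x) / 2 := by
    have hF : ∀ y ∈ Set.Ici (0 : ℝ), HasDerivAt
        (fun y : ℝ => -(Real.exp (-y) : ℂ) * (ψ (x + y) + ψ' (x + y)) / 2)
        ((Real.exp (-y) / 2 : ℝ) * (ψ - secondDeriv ψ) (x + y)) y := by
      intro y _
      have he : HasDerivAt (fun y : ℝ => ((Real.exp (-y) : ℝ) : ℂ)) ((-Real.exp (-y) : ℝ) : ℂ) y := by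
        have := ((hasDerivAt_neg y).exp).ofReal_comp
        simpa using this
      have := ((he.neg).mul ((hshift _ _ y hd).add (hshift _ _ y hd'))).div_const 2
      refine this.congr_deriv ?_
      simp only [sub_apply, Pi.add_apply, Pi.neg_apply]
      push_cast
      ring
    have hlim : Filter.Tendsto (fun y : ℝ => -(Real.exp (-y) : ℂ) * (ψ (x + y) + ψ' (x + y)) / 2)
        Filter.atTop (nhds 0) := by
      have he : Filter.Tendsto (fun y : ℝ => ((Real.exp (-y) : ℝ) : ℂ)) Filter.atTop (nhds 0) := by
        have := (Complex.continuous_ofReal.tendsto 0).comp Real.tendsto_exp_neg_atTop_nhds_zero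
        rwa [Complex.ofReal_zero] at this
      have := (he.neg.mul ((htop ψ).add (htop ψ'))).div_const 2
      simpa using this
    have h := integral_Ioi_of_hasDerivAt_of_tendsto' hF ?_ hlim
    · rw [setIntegral_congr_fun measurableSet_Ioi (g := fun y : ℝ =>
        ((Real.exp (-y) / 2 : ℝ) : ℂ) * (ψ - secondDeriv ψ) (x + y)), h]
      · simp
        ring
      · intro y hy
        simp only
        rw [greenKernel, abs_of_pos hy]
    · refine hint.integrableOn.congr_fun (fun y hy => ?_) measurableSet_Ioi
      simp only
      rw [greenKernel, abs_of_pos hy]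
  have h2 : ∫ y in Set.Iic (0 : ℝ), (greenKernel y : ℂ) * (ψ - secondDeriv ψ) (x + y) =
      (ψ x - ψ' x) / 2 := by
    have hF : ∀ y ∈ Set.Iic (0 : ℝ), HasDerivAt
        (fun y : ℝ => (Real.exp y : ℂ) * (ψ (x + y) - ψ' (x + y)) / 2)
        ((Real.exp y / 2 : ℝ) * (ψ - secondDeriv ψ) (x + y)) y := by
      intro y _
      have he : HasDerivAt (fun y : ℝ => ((Real.exp y : ℝ) : ℂ)) ((Real.exp y : ℝ) : ℂ) y :=
        (Real.hasDerivAt_exp y).ofReal_comp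
      have := (he.mul ((hshift _ _ y hd).sub (hshift _ _ y hd'))).div_const 2
      refine this.congr_deriv ?_
      simp only [sub_apply, Pi.sub_apply]
      push_cast
      ring
    have hlim : Filter.Tendsto (fun y : ℝ => (Real.exp y : ℂ) * (ψ (x + y) - ψ' (x + y)) / 2)
        Filter.atBot (nhds 0) := by
      have he : Filter.Tendsto (fun y : ℝ => ((Real.exp y : ℝ) : ℂ)) Filter.atBot (nhds 0) := by
        have := (Complex.continuous_ofReal.tendsto 0).comp Real.tendsto_exp_atBot
        rwa [Complex.ofReal_zero] at this
      have := (he.mul ((hbot ψ).sub (hbot ψ'))).div_const 2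
      simpa using this
    have h := integral_Iic_of_hasDerivAt_of_tendsto' hF ?_ hlim
    · rw [setIntegral_congr_fun measurableSet_Iic (g := fun y : ℝ =>
        ((Real.exp y / 2 : ℝ) : ℂ) * (ψ - secondDeriv ψ) (x + y)), h]
      · simp
      · intro y hy
        simp only
        rw [greenKernel, abs_of_nonpos hy, neg_neg]
    · refine hint.integrableOn.congr_fun (fun y hy => ?_) measurableSet_Iic
      simp only
      rw [greenKernel, abs_of_nonpos hy, neg_neg]
  rw [← integral_add_compl (measurableSet_Iic (a := (0 : ℝ))) hint, Set.compl_Iic, h1, h2]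
  ring

/-! ### Oscillating data -/

/-- Continuity of translations in `L¹`. It plays the role of the Riemann–Lebesgue lemma: it makes
both the convolutions with the profile and the fluctuations of its powers tend to zero. -/
theorem tendsto_integral_translate_sub {E : Type*} [NormedAddCommGroup E] {F : ℝ → E}
    (hF : Integrable F) :
    Filter.Tendsto (fun h : ℝ => ∫ y, ‖F (y + h) - F y‖) (nhds 0) (nhds 0) := by
  have hF1 : MemLp F 1 volume := memLp_one_iff_integrable.2 hF
  let g : ℝ → C(ℝ, ℝ) := fun h => ⟨fun y => y + h, by fun_prop⟩
  have hgc : Continuous g := by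
    refine ContinuousMap.continuous_of_continuous_uncurry _ ?_
    exact continuous_snd.add continuous_fst
  have hg : ∀ h, MeasurePreserving (g h) volume volume := fun h =>
    measurePreserving_add_right volume h
  have hc : Continuous fun h => Lp.compMeasurePreserving (g h) (hg h) (hF1.toLp F) :=
    Continuous.compMeasurePreservingLp continuous_const hgc hg (by simp)
  have hc' : Continuous fun h => ‖Lp.compMeasurePreserving (g h) (hg h) (hF1.toLp F) - hF1.toLp F‖ :=
    (hc.sub continuous_const).norm
  have h1 := hc'.tendsto' 0 0 (by
      rw [norm_eq_zero, sub_eq_zero]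
      apply Lp.ext
      refine (Lp.coeFn_compMeasurePreserving _ (hg 0)).trans ?_
      refine ae_of_all _ fun y => ?_
      simp [g])
  refine h1.congr fun h => ?_
  rw [L1.norm_eq_integral_norm]
  refine integral_congr_ae ?_
  have h2 := (hg h).quasiMeasurePreserving.ae hF1.coeFn_toLp
  filter_upwards [Lp.coeFn_sub (Lp.compMeasurePreserving (g h) (hg h) (hF1.toLp F)) (hF1.toLp F),
    Lp.coeFn_compMeasurePreserving (hF1.toLp F) (hg h), hF1.coeFn_toLp, h2] with y a b c d
  rw [a, Pi.sub_apply, b, c, Function.comp_apply, d]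
  rfl

/-- The left halves of the unit cells: `[0, 1/2)` on the line, its periodization on the torus. -/
def halfCells (M : SpatialDomain) : Set ℝ :=
  {x | ∃ q : ℤ, (M = .line → q = 0) ∧ (q : ℝ) ≤ x ∧ x < q + 1 / 2}

theorem measurableSet_halfCells (M : SpatialDomain) : MeasurableSet (halfCells M) := by
  have : halfCells M = ⋃ q : ℤ, {x : ℝ | (M = .line → q = 0) ∧ (q : ℝ) ≤ x ∧ x < q + 1 / 2} := by
    ext x
    simp [halfCells]
  rw [this]
  refine MeasurableSet.iUnion fun q => ?_
  exact (MeasurableSet.const _).inter (measurableSet_Ico (a := (q : ℝ)) (b := q + 1 / 2))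

theorem measure_halfCells_le (M : SpatialDomain) : M.measure (halfCells M) ≤ 1 := by
  cases M with
  | line =>
    have : halfCells .line ⊆ Set.Ico (0 : ℝ) 1 := by
      rintro x ⟨q, hq, h1, h2⟩
      rw [hq rfl] at h1 h2
      norm_num at h1 h2
      exact ⟨h1, by linarith⟩
    refine (measure_mono this).trans ?_
    change volume _ ≤ _
    simp
  | torus =>
    refine (measure_mono (Set.subset_univ _)).trans ?_
    change (volume.restrict _) _ ≤ _
    simp

theorem add_one_mem_halfCells (x : ℝ) : x + 1 ∈ halfCells .torus ↔ x ∈ halfCells .torus := by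
  constructor
  · rintro ⟨q, -, h1, h2⟩
    exact ⟨q - 1, by simp, by push_cast; linarith, by push_cast; linarith⟩
  · rintro ⟨q, -, h1, h2⟩
    exact ⟨q + 1, by simp, by push_cast; linarith, by push_cast; linarith⟩

theorem isAdmissible_of_support {f : ℝ → ℝ} (hf : Measurable f) {C : ℝ} (hC : ∀ x, |f x| ≤ C)
    (hs : ∀ x, x ∉ halfCells M → f x = 0) (hp : M = .torus → ∀ x, f (x + 1) = f x) :
    ∃ h : IsAdmissible 𝕂 M (fun x => (f x : ℂ)), ‖ofFun h‖ ≤ C := by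
  have hC0 : 0 ≤ C := (abs_nonneg _).trans (hC 0)
  have hm : Measurable fun x => (f x : ℂ) := Complex.measurable_ofReal.comp hf
  have hb : ∀ x, ‖(f x : ℂ)‖ ≤ C := fun x => by
    rw [Complex.norm_real]
    exact hC x
  have hl : ∫⁻ x, ‖(f x : ℂ)‖ₑ ^ 2 ∂M.measure ≤ ENNReal.ofReal C ^ 2 := by
    calc _ ≤ ∫⁻ x, (halfCells M).indicator (fun _ => ENNReal.ofReal C ^ 2) x ∂M.measure := by
          refine lintegral_mono fun x => ?_
          by_cases hx : x ∈ halfCells M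
          · rw [Set.indicator_of_mem hx, ← ofReal_norm]
            gcongr
            exact hb x
          · simp [hs x hx]
      _ = ENNReal.ofReal C ^ 2 * M.measure (halfCells M) := by
          rw [lintegral_indicator (measurableSet_halfCells M), setLIntegral_const]
      _ ≤ ENNReal.ofReal C ^ 2 * 1 := by
          gcongr
          exact measure_halfCells_le M
      _ = _ := mul_one _
  refine ⟨⟨memLp_top_of_bound hm.aestronglyMeasurable C (ae_of_all _ hb),
    (memLp_two_of_lintegral hm.aestronglyMeasurable hl).1, ae_of_all _ fun x => ?_,
    fun hM => ae_of_all _ fun x => ?_⟩, norm_ofFun_le _ hC0 (ae_of_all _ hb) hl⟩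
  · exact 𝕂.algebraMap_mem (f x)
  · rw [hp hM]

/-- Each half cell is made of the `3 m` cells with indices from `6 m q` to `6 m q + 3 m - 1`. Both
ends of this range are aligned with multiples of three, so no triple of cells starting at a multiple
of three straddles its boundary. -/
theorem mem_halfCells_iff {m : ℕ} (hm : 0 < m) (x : ℝ) : x ∈ halfCells M ↔
    ∃ q : ℤ, (M = .line → q = 0) ∧ 6 * (m * q) ≤ ⌊6 * m * x⌋ ∧ ⌊6 * m * x⌋ < 6 * (m * q) + 3 * m := by
  have hm' : (0 : ℝ) < m := Nat.cast_pos.2 hm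
  refine exists_congr fun q => and_congr_right fun _ => and_congr ?_ ?_
  · rw [Int.le_floor]
    push_cast
    constructor
    · intro h
      nlinarith
    · intro h
      by_contra hx
      nlinarith
  · rw [Int.floor_lt]
    push_cast
    constructor
    · intro h
      nlinarith
    · intro h
      by_contra hx
      nlinarith

/-- The indicator of the cells of length `1 / (6 m)` in the left halves of the unit cells whose
index is a multiple of three. -/
def comb (M : SpatialDomain) (m : ℕ) : ℝ → ℝ :=
  Set.indicator {x | x ∈ halfCells M ∧ (3 : ℤ) ∣ ⌊6 * m * x⌋} 1

/-- The oscillating profile, with values `2` and `-1` on one third and two thirds of the left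
halves of the unit cells. -/
def profile (M : SpatialDomain) (m : ℕ) (x : ℝ) : ℝ :=
  2 * comb M m x - comb M m (x - 1 / (6 * m)) - comb M m (x - 2 * (1 / (6 * m)))

theorem comb_eq (m : ℕ) (x : ℝ) [Decidable (x ∈ halfCells M)] :
    comb M m x = if x ∈ halfCells M then (if (3 : ℤ) ∣ ⌊6 * m * x⌋ then 1 else 0) else 0 := by
  classical
  rw [comb, Set.indicator_apply]
  simp only [Set.mem_ofPred_eq, Pi.one_apply]
  split_ifs <;> tauto

/-- By this alignment, moving the comb by one or two cells stays inside the same half cell. The comb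
and its two translates therefore partition the half cells. -/
theorem comb_translate {m : ℕ} (hm : 0 < m) (x : ℝ) [Decidable (x ∈ halfCells M)] :
    comb M m (x - 1 / (6 * m)) =
      (if x ∈ halfCells M then (if (3 : ℤ) ∣ ⌊6 * m * x⌋ - 1 then 1 else 0) else 0) ∧
    comb M m (x - 2 * (1 / (6 * m))) =
      (if x ∈ halfCells M then (if (3 : ℤ) ∣ ⌊6 * m * x⌋ - 2 then 1 else 0) else 0) := by
  classical
  have hm' : (m : ℝ) ≠ 0 := Nat.cast_ne_zero.2 hm.ne'
  have key : ∀ j : ℤ, (j = 1 ∨ j = 2) → comb M m (x - j * (1 / (6 * m))) =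
      (if x ∈ halfCells M then (if (3 : ℤ) ∣ ⌊6 * m * x⌋ - j then 1 else 0) else 0) := by
    intro j hj
    have hfl : ⌊6 * m * (x - j * (1 / (6 * m)))⌋ = ⌊6 * m * x⌋ - j := by
      rw [← Int.floor_sub_intCast]
      congr 1
      field_simp
    rw [comb, Set.indicator_apply]
    simp only [Set.mem_ofPred_eq, Pi.one_apply, mem_halfCells_iff hm, hfl]
    by_cases h3 : (3 : ℤ) ∣ ⌊6 * m * x⌋ - j
    · simp only [h3, and_true, if_true]
      congr 1
      refine propext (exists_congr fun q => and_congr_right fun _ => ?_)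
      generalize (m : ℤ) * q = p
      omega
    · simp [h3]
  have h1 := key 1 (Or.inl rfl)
  have h2 := key 2 (Or.inr rfl)
  push_cast at h1 h2
  rw [one_mul] at h1
  exact ⟨h1, h2⟩

theorem measurable_comb (M : SpatialDomain) (m : ℕ) : Measurable (comb M m) := by
  refine measurable_one.indicator ((measurableSet_halfCells M).inter ?_)
  have : Measurable fun x : ℝ => ⌊6 * m * x⌋ := (measurable_const.mul measurable_id).floor
  exact this (MeasurableSet.of_discrete (s := {n : ℤ | (3 : ℤ) ∣ n}))

theorem measurable_profile (M : SpatialDomain) (m : ℕ) : Measurable (profile M m) := by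
  have := measurable_comb M m
  unfold profile
  fun_prop

theorem abs_comb_le (m : ℕ) (x : ℝ) : |comb M m x| ≤ 1 := by
  classical
  rw [comb_eq]
  split_ifs <;> norm_num

theorem comb_eq_zero (m : ℕ) (x : ℝ) (hx : x ∉ halfCells M) : comb M m x = 0 := by
  classical
  rw [comb_eq, if_neg hx]

theorem comb_add_one (m : ℕ) (x : ℝ) : comb .torus m (x + 1) = comb .torus m x := by
  classical
  have : ⌊6 * m * (x + 1)⌋ = ⌊6 * m * x⌋ + 6 * m := by
    rw [show 6 * m * (x + 1) = 6 * m * x + ((6 * m : ℤ) : ℝ) by push_cast; ring, Int.floor_add_intCast]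
  rw [comb_eq, comb_eq, this]
  simp only [add_one_mem_halfCells]
  congr 2
  exact propext (by omega)

theorem profile_eq {m : ℕ} (hm : 0 < m) (x : ℝ) [Decidable (x ∈ halfCells M)] :
    profile M m x = if x ∈ halfCells M then (if (3 : ℤ) ∣ ⌊6 * m * x⌋ then 2 else -1) else 0 := by
  rw [profile, comb_eq, (comb_translate hm x).1, (comb_translate hm x).2]
  have : (3 : ℤ) ∣ ⌊6 * m * x⌋ ∨ (3 : ℤ) ∣ ⌊6 * m * x⌋ - 1 ∨ (3 : ℤ) ∣ ⌊6 * m * x⌋ - 2 := by omega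
  split_ifs <;> first | (exfalso; omega) | norm_num

theorem abs_profile_le {m : ℕ} (hm : 0 < m) (x : ℝ) : |profile M m x| ≤ 2 := by
  classical
  rw [profile_eq hm]
  split_ifs <;> norm_num

theorem profile_eq_zero {m : ℕ} (hm : 0 < m) (x : ℝ) (hx : x ∉ halfCells M) :
    profile M m x = 0 := by
  classical
  rw [profile_eq hm, if_neg hx]

theorem profile_add_one (m : ℕ) (x : ℝ) : profile .torus m (x + 1) = profile .torus m x := by
  simp only [profile, add_sub_right_comm, comb_add_one]

theorem isAdmissible_comb (m : ℕ) :
    ∃ h : IsAdmissible 𝕂 M (fun x => (comb M m x : ℂ)), ‖ofFun h‖ ≤ 1 :=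
  isAdmissible_of_support (measurable_comb M m) (abs_comb_le m) (comb_eq_zero m) (by
    rintro rfl
    exact comb_add_one m)

theorem isAdmissible_profile {m : ℕ} (hm : 0 < m) :
    ∃ h : IsAdmissible 𝕂 M (fun x => (profile M m x : ℂ)), ‖ofFun h‖ ≤ 2 :=
  isAdmissible_of_support (measurable_profile M m) (abs_profile_le hm) (profile_eq_zero hm) (by
    rintro rfl
    exact profile_add_one m)

theorem tendsto_cell_length : Filter.Tendsto (fun m : ℕ => (1 : ℝ) / (6 * m)) Filter.atTop (nhds 0) := by
  have := (tendsto_one_div_atTop_nhds_zero_nat (𝕜 := ℝ)).const_mul (1 / 6)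
  rw [mul_zero] at this
  refine this.congr fun m => ?_
  rw [one_div_mul_one_div]

theorem tendsto_translates {E : Type*} [NormedAddCommGroup E] {F : ℝ → E} (hF : Integrable F)
    (c : ℝ) : Filter.Tendsto (fun m : ℕ => (∫ y, ‖F (y + c * (1 / (6 * m))) - F y‖) +
      ∫ y, ‖F (y + c * (2 * (1 / (6 * m)))) - F y‖) Filter.atTop (nhds 0) := by
  have h1 : Filter.Tendsto (fun m : ℕ => c * (1 / (6 * m))) Filter.atTop (nhds 0) := by
    simpa using tendsto_cell_length.const_mul c
  have h2 : Filter.Tendsto (fun m : ℕ => c * (2 * (1 / (6 * m)))) Filter.atTop (nhds 0) := by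
    simpa using (tendsto_cell_length.const_mul 2).const_mul c
  have h := ((tendsto_integral_translate_sub hF).comp h1).add
    ((tendsto_integral_translate_sub hF).comp h2)
  rwa [add_zero] at h

theorem convFun_translate {K : ℝ → ℝ} (f : ℝ → ℂ) (h x : ℝ) :
    convFun K (fun z => f (z - h)) x = convFun (fun y => K (y + -h)) f x := by
  simp only [convFun]
  rw [← integral_sub_right_eq_self _ h]
  congr 1
  ext y
  rw [← sub_eq_add_neg]
  congr 2
  ring

/-- The profile is a combination of translates of the comb with coefficients `2, -1, -1` of zero
sum. Moving the translations onto the kernel leaves differences `K (· - h) - K` and `K (· - 2 h) -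
K` convolved with a comb of norm at most one. -/
theorem norm_convLin_profile_le {K : ℝ → ℝ} (hK : Integrable K) {m : ℕ} {g : L2Linf 𝕂 M}
    (hg : L2Linf.fn g =ᵐ[volume] fun x => (profile M m x : ℂ)) :
    ‖convLin hK g‖ ≤ (∫ y, ‖K (y + -1 * (1 / (6 * m))) - K y‖) +
      ∫ y, ‖K (y + -1 * (2 * (1 / (6 * m)))) - K y‖ := by
  obtain ⟨hb, hb1⟩ := isAdmissible_comb (𝕂 := 𝕂) (M := M) m
  set b := ofFun hb
  have hbf : L2Linf.fn b =ᵐ[volume] fun x => (comb M m x : ℂ) := fn_ofFun hb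
  set h : ℝ := 1 / (6 * m)
  have hK1 : Integrable fun y => K (y + -1 * h) - K y := (hK.comp_add_right _).sub hK
  have hK2 : Integrable fun y => K (y + -1 * (2 * h)) - K y := (hK.comp_add_right _).sub hK
  have hi : ∀ {K : ℝ → ℝ}, Integrable K → ∀ x : ℝ,
      Integrable fun y => (K y : ℂ) * (comb M m (x - y) : ℂ) := fun hK x => by
    refine (integrable_convFun hK b x).congr ?_
    filter_upwards [ae_sub_left x hbf] with y hy
    rw [hy]
  have heq : convLin hK g = - (convLin hK1 b + convLin hK2 b) := by
    rw [eq_neg_iff_add_eq_zero]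
    apply ext_fn
    filter_upwards [fn_add (convLin hK g) (convLin hK1 b + convLin hK2 b),
      fn_add (convLin hK1 b) (convLin hK2 b), fn_convLin hK g, fn_convLin hK1 b,
      fn_convLin hK2 b, fn_zero (𝕂 := 𝕂) (M := M)] with x a1 a2 a3 a4 a5 a6
    rw [a1, a2, a3, a4, a5, a6, convFun_congr hg, convFun_congr hbf, convFun_congr hbf]
    have e1 := convFun_translate (K := K) (fun z => (comb M m z : ℂ)) h x
    have e2 := convFun_translate (K := K) (fun z => (comb M m z : ℂ)) (2 * h) x
    have i0 := hi hK x
    have i1 := hi (hK.comp_add_right (-1 * h)) x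
    have i2 := hi (hK.comp_add_right (-1 * (2 * h))) x
    have j1 := hi hK (x - h)
    have j2 := hi hK (x - 2 * h)
    simp only [convFun, neg_one_mul] at *
    have e0 : ∫ y, (K y : ℂ) * (profile M m (x - y) : ℂ) = 2 * (∫ y, (K y : ℂ) * (comb M m (x - y) : ℂ))
        - (∫ y, (K y : ℂ) * (comb M m (x - y - h) : ℂ))
        - ∫ y, (K y : ℂ) * (comb M m (x - y - 2 * h) : ℂ) := by
      have j1' : Integrable fun y => (K y : ℂ) * (comb M m (x - y - h) : ℂ) := by
        simpa only [sub_right_comm] using j1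
      have j2' : Integrable fun y => (K y : ℂ) * (comb M m (x - y - 2 * h) : ℂ) := by
        simpa only [sub_right_comm] using j2
      have j0 : Integrable fun y => 2 * ((K y : ℂ) * (comb M m (x - y) : ℂ)) -
          (K y : ℂ) * (comb M m (x - y - h) : ℂ) := (i0.const_mul 2).sub j1'
      rw [← integral_const_mul, ← integral_sub (i0.const_mul 2) j1', ← integral_sub j0 j2']
      congr 1
      ext y
      rw [profile]
      push_cast
      ring
    rw [e0, e1, e2]
    simp only [Complex.ofReal_sub, sub_mul]
    rw [integral_sub i1 i0, integral_sub i2 i0]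
    ring
  rw [heq, norm_neg]
  refine (norm_add_le _ _).trans (add_le_add ?_ ?_)
  · exact (norm_convLin_le hK1 b).trans
      (mul_le_of_le_one_right (integral_nonneg fun _ => abs_nonneg _) hb1)
  · exact (norm_convLin_le hK2 b).trans
      (mul_le_of_le_one_right (integral_nonneg fun _ => abs_nonneg _) hb1)

/-- Splits a power of the profile, which is `2^(n+1)` on one cell in three and `(-1)^(n+1)` on the
other two, into its average over the half cells and differences of translates of the comb. The
factor three clears the denominator of the average. -/
theorem comb_identities {m : ℕ} (hm : 0 < m) (n : ℕ) (x : ℝ) :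
    3 * (profile M m x) ^ (n + 1) =
      (2 ^ (n + 1) + 2 * (-1) ^ (n + 1)) * (halfCells M).indicator 1 x +
      (3 * (-1) ^ (n + 1) - (2 ^ (n + 1) + 2 * (-1) ^ (n + 1))) *
        ((comb M m (x - 1 / (6 * m)) - comb M m x) +
          (comb M m (x - 2 * (1 / (6 * m))) - comb M m x)) := by
  classical
  rw [profile_eq hm, (comb_translate hm x).1, (comb_translate hm x).2, comb_eq m x,
    Set.indicator_apply]
  simp only [Pi.one_apply]
  have : (3 : ℤ) ∣ ⌊6 * m * x⌋ ∨ (3 : ℤ) ∣ ⌊6 * m * x⌋ - 1 ∨ (3 : ℤ) ∣ ⌊6 * m * x⌋ - 2 := by omega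
  split_ifs <;> first | (exfalso; omega) | ring

theorem norm_integral_translate_sub_le {f : ℝ → ℝ} (hf : Measurable f) (hf1 : ∀ x, |f x| ≤ 1)
    {θ : ℝ → ℂ} (hθ : Integrable θ) (h : ℝ) :
    ‖∫ x, θ x * ((f (x - h) - f x : ℝ) : ℂ)‖ ≤ ∫ x, ‖θ (x + h) - θ x‖ := by
  have hi : ∀ {θ : ℝ → ℂ} {f : ℝ → ℝ}, Integrable θ → Measurable f → (∀ x, |f x| ≤ 1) →
      Integrable fun x => θ x * (f x : ℂ) := fun hθ hf hf1 =>
    hθ.mul_bdd (c := 1) (Complex.measurable_ofReal.comp hf).aestronglyMeasurable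
      (ae_of_all _ fun x => by rw [Complex.norm_real]; exact hf1 x)
  have hfh : Measurable fun x => f (x - h) := hf.comp (measurable_id.sub_const h)
  have h1 : ∫ x, θ x * ((f (x - h) - f x : ℝ) : ℂ) = ∫ x, (θ (x + h) - θ x) * (f x : ℂ) := by
    simp only [Complex.ofReal_sub, mul_sub, sub_mul]
    rw [integral_sub (hi hθ hfh fun x => hf1 _) (hi hθ hf hf1),
      integral_sub (hi (hθ.comp_add_right h) hf hf1) (hi hθ hf hf1)]
    congr 1
    rw [← integral_add_right_eq_self _ h]
    simp only [add_sub_cancel_right]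
  rw [h1]
  refine norm_integral_le_of_norm_le ((hθ.comp_add_right h).sub hθ).norm (ae_of_all _ fun x => ?_)
  rw [norm_mul, Complex.norm_real]
  exact mul_le_of_le_one_right (norm_nonneg _) (hf1 x)

/-- Weak convergence of the powers of the profile to their average on the half cells: in the
pairing, the translations of the comb pass to `θ`, where they cost only an `L¹` modulus of
continuity. -/
theorem tendsto_integral_profile_pow (M : SpatialDomain) (n : ℕ) {θ : ℝ → ℂ} (hθ : Integrable θ) :
    Filter.Tendsto (fun m : ℕ => 3 * ∫ x, θ x * (profile M m x : ℂ) ^ (n + 1)) Filter.atTop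
      (nhds ((2 ^ (n + 1) + 2 * (-1) ^ (n + 1)) * ∫ x in halfCells M, θ x)) := by
  have hi : ∀ {f : ℝ → ℝ}, Measurable f → (∀ x, |f x| ≤ 2) →
      Integrable fun x => θ x * (f x : ℂ) := fun hf hf1 =>
    hθ.mul_bdd (c := 2) (Complex.measurable_ofReal.comp hf).aestronglyMeasurable
      (ae_of_all _ fun x => by rw [Complex.norm_real]; exact hf1 x)
  set A : ℝ := 2 ^ (n + 1) + 2 * (-1) ^ (n + 1) with hA
  set B : ℝ := 3 * (-1) ^ (n + 1) - A with hB
  have hlim := (tendsto_translates hθ 1).const_mul |B|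
  rw [mul_zero] at hlim
  rw [← tendsto_sub_nhds_zero_iff]
  refine squeeze_zero_norm' ?_ hlim
  filter_upwards [Filter.eventually_gt_atTop 0] with m hm
  set h : ℝ := 1 / (6 * m) with hh
  have hcm := measurable_comb M m
  have hd : ∀ c : ℝ, Integrable fun x => θ x * ((comb M m (x - c) - comb M m x : ℝ) : ℂ) := by
    intro c
    refine hi ((hcm.comp (measurable_id.sub_const c)).sub hcm) fun x => ?_
    have := abs_comb_le (M := M) m x
    have := abs_comb_le (M := M) m (x - c)
    exact (abs_sub _ _).trans (by linarith)
  have hE : ∫ x in halfCells M, θ x = ∫ x, θ x * (((halfCells M).indicator (1 : ℝ → ℝ) x : ℝ) : ℂ) := by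
    rw [← integral_indicator (measurableSet_halfCells M)]
    congr 1
    ext x
    by_cases hx : x ∈ halfCells M <;> simp [hx]
  have hiE : Integrable fun x => θ x * (((halfCells M).indicator (1 : ℝ → ℝ) x : ℝ) : ℂ) := by
    refine hi (measurable_one.indicator (measurableSet_halfCells M)) fun x => ?_
    by_cases hx : x ∈ halfCells M <;> simp [hx]
  have key : 3 * (∫ x, θ x * (profile M m x : ℂ) ^ (n + 1)) -
      (2 ^ (n + 1) + 2 * (-1) ^ (n + 1)) * ∫ x in halfCells M, θ x =
      (B : ℂ) * ((∫ x, θ x * ((comb M m (x - h) - comb M m x : ℝ) : ℂ)) +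
        ∫ x, θ x * ((comb M m (x - 2 * h) - comb M m x : ℝ) : ℂ)) := by
    have hA' : (2 ^ (n + 1) + 2 * (-1) ^ (n + 1) : ℂ) = (A : ℂ) := by
      rw [hA]
      push_cast
      ring
    have hd2 : Integrable fun x => (B : ℂ) * (θ x * ((comb M m (x - h) - comb M m x : ℝ) : ℂ) +
        θ x * ((comb M m (x - 2 * h) - comb M m x : ℝ) : ℂ)) :=
      ((hd h).add (hd (2 * h))).const_mul _
    rw [hA', sub_eq_iff_eq_add, hE, ← integral_const_mul, ← integral_const_mul,
      ← integral_add (hd h) (hd (2 * h)), ← integral_const_mul,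
      ← integral_add hd2 (hiE.const_mul _)]
    congr 1
    ext x
    have := congrArg (fun r : ℝ => (r : ℂ)) (comb_identities (M := M) hm n x)
    rw [← hh, ← hA, ← hB] at this
    push_cast at this
    push_cast
    linear_combination θ x * this
  rw [key, norm_mul, Complex.norm_real, Real.norm_eq_abs]
  refine mul_le_mul_of_nonneg_left ((norm_add_le _ _).trans (add_le_add ?_ ?_)) (abs_nonneg _)
  · rw [one_mul]
    exact norm_integral_translate_sub_le hcm (abs_comb_le m) hθ h
  · rw [one_mul]
    exact norm_integral_translate_sub_le hcm (abs_comb_le m) hθ (2 * h)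

/-- A test function whose second derivative has a nonzero integral over the left halves of the
unit cells. -/
theorem exists_schwartz_integral_secondDeriv (M : SpatialDomain) :
    ∃ ψ : 𝓢(ℝ, ℂ), ∫ x in halfCells M, secondDeriv ψ x = 1 := by
  -- The test function is `x - 1/2` times a bump around `1/2`. Its derivative is `1` at `1/2` and
  -- `0` at `0`, so its second derivative has integral one over `[0, 1/2)`. On its support,
  -- contained in `[1/4, 3/4]`, the half cells of either domain coincide with that interval. Whole
  -- cells would not do: on the torus they fill the line, where a second derivative integrates to
  -- zero.
  let f : ContDiffBump (1 / 2 : ℝ) := ⟨1 / 8, 1 / 4, by norm_num, by norm_num⟩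
  let F : ℝ → ℂ := fun x => (x - 1 / 2 : ℂ) * (f x : ℂ)
  have hFd : ContDiff ℝ ((⊤ : ℕ∞) : WithTop ℕ∞) F := by
    refine (Complex.ofRealCLM.contDiff.sub contDiff_const).mul (Complex.ofRealCLM.contDiff.comp ?_)
    exact f.contDiff
  have hFz : ∀ x, 1 / 4 ≤ |x - 1 / 2| → F x = 0 := fun x hx => by
    have : f x = 0 := f.zero_of_le_dist (by rwa [Real.dist_eq])
    simp [F, this]
  have hFc : HasCompactSupport F := by
    refine HasCompactSupport.of_support_subset_isCompact (isCompact_Icc (a := (0 : ℝ)) (b := 1)) ?_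
    intro x hx
    by_contra hx'
    refine hx (hFz x ?_)
    by_contra h
    rw [not_le, abs_lt] at h
    exact hx' ⟨by linarith, by linarith⟩
  let ψ : 𝓢(ℝ, ℂ) := hFc.toSchwartzMap hFd
  have hψ : ∀ x, ψ x = F x := fun x => rfl
  let ψ' := SchwartzMap.derivCLM ℂ ℂ ψ
  have hψ' : ∀ x, ψ' x = deriv ψ x := fun x => SchwartzMap.derivCLM_apply ℂ ψ x
  have hd' : ∀ y, HasDerivAt ψ' (secondDeriv ψ y) y := fun y => by
    rw [secondDeriv, SchwartzMap.derivCLM_apply]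
    exact ψ'.differentiableAt.hasDerivAt
  have hz : ∀ x, 1 / 4 < |x - 1 / 2| → ψ =ᶠ[nhds x] fun _ => 0 := by
    intro x hx
    have : Continuous fun x : ℝ => |x - 1 / 2| := by fun_prop
    filter_upwards [(isOpen_lt continuous_const this).mem_nhds hx] with y hy
    exact hFz y (le_of_lt hy)
  have hz' : ∀ x, 1 / 4 < |x - 1 / 2| → secondDeriv ψ x = 0 := by
    intro x hx
    rw [secondDeriv_apply, ((hz x hx).deriv).deriv_eq]
    simp
  have h0 : ψ' 0 = 0 := by
    rw [hψ', (hz 0 (by norm_num [abs_of_pos])).deriv_eq]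
    simp
  have h1 : ψ' (1 / 2) = 1 := by
    have he : ψ =ᶠ[nhds (1 / 2 : ℝ)] fun x => (x - 1 / 2 : ℂ) := by
      filter_upwards [Metric.closedBall_mem_nhds (1 / 2 : ℝ) f.rIn_pos] with x hx
      rw [hψ]
      simp [F, f.one_of_mem_closedBall hx]
    rw [hψ', he.deriv_eq]
    have := ((hasDerivAt_id (1 / 2 : ℝ)).ofReal_comp.sub_const (1 / 2 : ℂ)).deriv
    simpa using this
  refine ⟨ψ, ?_⟩
  have hset : ∫ x in halfCells M, secondDeriv ψ x = ∫ x in Set.Ico (0 : ℝ) (1 / 2), secondDeriv ψ x := by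
    rw [← integral_indicator (measurableSet_halfCells M), ← integral_indicator measurableSet_Ico]
    congr 1
    ext x
    by_cases hx : 1 / 4 < |x - 1 / 2|
    · simp [Set.indicator_apply, hz' x hx]
    · have hx1 : 1 / 4 ≤ x ∧ x ≤ 3 / 4 := by
        rw [not_lt, abs_le] at hx
        constructor <;> linarith [hx.1, hx.2]
      have hiff : x ∈ halfCells M ↔ x ∈ Set.Ico (0 : ℝ) (1 / 2) := by
        constructor
        · rintro ⟨q, -, h2, h3⟩
          have hq1 : q < 1 := by
            have : (q : ℝ) < 1 := by linarith
            exact_mod_cast this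
          have hq2 : -1 < q := by
            have : (-1 : ℝ) < q := by linarith
            exact_mod_cast this
          obtain rfl : q = 0 := by omega
          norm_num at h2 h3
          exact ⟨h2, by linarith⟩
        · rintro ⟨h2, h3⟩
          exact ⟨0, fun _ => rfl, by simpa using h2, by simpa using h3⟩
      by_cases hx2 : x ∈ halfCells M
      · rw [Set.indicator_of_mem hx2, Set.indicator_of_mem (hiff.1 hx2)]
      · rw [Set.indicator_of_notMem hx2, Set.indicator_of_notMem (hx2 ∘ hiff.2)]
  rw [hset, integral_Ico_eq_integral_Ioc, ← intervalIntegral.integral_of_le (by norm_num),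
    intervalIntegral.integral_eq_sub_of_hasDerivAt (fun x _ => hd' x)
      ((secondDeriv ψ).continuous.intervalIntegrable _ _), h0, h1, sub_zero]

/-- For exponent one this is the vanishing mean of the profile; from exponent two on, `2^(n+1) ≥ 4`
beats the other term. This is where `k ≥ 2` enters the choice of data. -/
theorem profile_average_ne_zero {n : ℕ} (hn : n ≠ 0) :
    (2 ^ (n + 1) + 2 * (-1) ^ (n + 1) : ℂ) ≠ 0 := by
  have h : (0 : ℝ) < 2 ^ (n + 1) + 2 * (-1) ^ (n + 1) := by
    have h1 : (2 : ℝ) ^ 2 ≤ 2 ^ (n + 1) := pow_le_pow_right₀ (by norm_num) (by omega)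
    rcases neg_one_pow_eq_or ℝ (n + 1) with h2 | h2 <;> rw [h2] <;> linarith
  have := Complex.ofReal_ne_zero.2 h.ne'
  push_cast at this
  exact this

/-- Bounded data which tend to zero in `W^{s,2,∞}(M)` while their `(n + 1)`-st powers do not tend
to zero when tested against the second derivative of a fixed function. -/
theorem exists_oscillating_data (𝕂 : Subalgebra ℝ ℂ) (M : SpatialDomain) (hs : s < 0) {n : ℕ}
    (hn : n ≠ 0) : ∃ (ψ : 𝓢(ℝ, ℂ)) (κ : ℝ), 0 < κ ∧ ∀ δ > 0, ∃ g : L2Linf 𝕂 M, ‖g‖ ≤ 2 ∧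
      ‖besselOp hs g‖ < δ ∧ κ ≤ ‖L2Linf.toDist (power n g) (secondDeriv ψ)‖ := by
  obtain ⟨ψ, hψ⟩ := exists_schwartz_integral_secondDeriv M
  set c : ℂ := 2 ^ (n + 1) + 2 * (-1) ^ (n + 1) with hc
  have hc0 : 0 < ‖c‖ := norm_pos_iff.2 (profile_average_ne_zero hn)
  have h1 := (tendsto_integral_profile_pow M n (secondDeriv ψ).integrable).norm
  rw [hψ, mul_one, ← hc] at h1
  have hβ : 0 < -s / 2 := by linarith
  have h2 := tendsto_translates (integrable_besselKernel hβ) (-1)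
  -- Three times the pairing tends to `c`, so its norm eventually exceeds `‖c‖ / 2`.
  refine ⟨ψ, ‖c‖ / 6, by positivity, fun δ hδ => ?_⟩
  obtain ⟨m, hm1, hm2, hm⟩ := ((h1.eventually_const_lt (half_lt_self hc0)).and
    ((h2.eventually_lt_const hδ).and (Filter.eventually_gt_atTop 0))).exists
  obtain ⟨hg, hg2⟩ := isAdmissible_profile (𝕂 := 𝕂) (M := M) hm
  refine ⟨ofFun hg, hg2, ?_, ?_⟩
  · exact (norm_convLin_profile_le (integrable_besselKernel hβ) (fn_ofFun hg)).trans_lt hm2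
  · have h3 : L2Linf.toDist (power n (ofFun hg)) (secondDeriv ψ) =
        ∫ x, secondDeriv ψ x * (profile M m x : ℂ) ^ (n + 1) := by
      rw [L2Linf.toDist_apply]
      refine integral_congr_ae ?_
      filter_upwards [fn_power n (ofFun hg), fn_ofFun hg] with x a b
      rw [a, b]
    rw [h3]
    rw [norm_mul, Complex.norm_ofNat] at hm1
    linarith

/-! ### Local solutions and their Taylor expansion in time -/

/-- Picard–Lindelöf, carried out on the fixed point of the Picard map in order to retain that the
solution stays in the ball, which the error estimate uses. -/
theorem exists_autonomous_solution {E : Type*} [NormedAddCommGroup E] [NormedSpace ℝ E]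
    [CompleteSpace E] {f : E → E} {x₀ : E} {R L K τ : ℝ} (hR : 0 ≤ R) (hL : 0 ≤ L) (hτ : 0 ≤ τ)
    (hlip : ∀ x ∈ Metric.closedBall x₀ R, ∀ y ∈ Metric.closedBall x₀ R,
      ‖f x - f y‖ ≤ K * ‖x - y‖) (hK : 0 ≤ K)
    (hbd : ∀ x ∈ Metric.closedBall x₀ R, ‖f x‖ ≤ L) (hLτ : L * τ ≤ R) :
    ∃ z : ℝ → E, z 0 = x₀ ∧ ∀ t ∈ Set.Icc (-τ) τ,
      HasDerivWithinAt z (f (z t)) (Set.Icc (-τ) τ) t ∧ z t ∈ Metric.closedBall x₀ R := by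
  lift R to NNReal using hR
  lift L to NNReal using hL
  lift K to NNReal using hK
  have h0 : (0 : ℝ) ∈ Set.Icc (-τ) τ := ⟨by linarith, hτ⟩
  have hl : LipschitzOnWith K f (Metric.closedBall x₀ R) := by
    refine LipschitzOnWith.of_dist_le_mul fun x hx y hy => ?_
    rw [dist_eq_norm, dist_eq_norm]
    exact hlip x hx y hy
  have hf : IsPicardLindelof (fun _ => f) (⟨0, h0⟩ : Set.Icc (-τ) τ) x₀ R 0 L K :=
    ⟨fun _ _ => hl, fun _ _ => continuousOn_const, fun _ _ x hx => hbd x hx, by simpa using hLτ⟩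
  have hx : x₀ ∈ Metric.closedBall x₀ ((0 : NNReal) : ℝ) := by simp
  obtain ⟨α, hα⟩ := ODE.FunSpace.exists_isFixedPt_next hf hx
  have hmem : ∀ t, α.compProj t ∈ Metric.closedBall x₀ R := fun t =>
    α.compProj_mem_closedBall hf.mul_max_le
  have hpic : ∀ t ∈ Set.Icc (-τ) τ, α.compProj t = ODE.picard (fun _ => f) 0 x₀ α.compProj t := by
    intro t ht
    conv_lhs => rw [← hα]
    rw [ODE.FunSpace.compProj_apply, ODE.FunSpace.next_apply, Set.projIcc_of_mem _ ht]
  refine ⟨α.compProj, ?_, fun t ht => ⟨?_, hmem t⟩⟩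
  · rw [hpic 0 h0, ODE.picard_apply₀]
  · refine (ODE.hasDerivWithinAt_picard_Icc h0 hf.continuousOn_uncurry
      α.continuous_compProj.continuousOn (fun t _ => hmem t) x₀ ht).congr hpic (hpic t ht)

/-- The integral of the Green kernel plus one, a bound for `∂² (1 - ∂²)⁻¹`. -/
def greenBound : ℝ := (∫ y, |greenKernel y|) + 1

theorem greenBound_nonneg : 0 ≤ greenBound :=
  add_nonneg (integral_nonneg fun _ => abs_nonneg _) zero_le_one

/-- The nonlinearity `u ↦ ∂² (1 - ∂²)⁻¹ (u + u ^ (n + 1))`. -/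
def nonlinearity (n : ℕ) (u : L2Linf 𝕂 M) : L2Linf 𝕂 M :=
  convLin integrable_greenKernel (u + power n u) - (u + power n u)

/-- The operator is `(1 - ∂²)⁻¹ - 1`. Testing against `(1 - ∂²) ψ` cancels the inverse and leaves
the local pairing with `ψ''`. -/
theorem toDist_nonlinearity (n : ℕ) (u : L2Linf 𝕂 M) (ψ : 𝓢(ℝ, ℂ)) :
    L2Linf.toDist (nonlinearity n u) (ψ - secondDeriv ψ) =
      L2Linf.toDist u (secondDeriv ψ) + L2Linf.toDist (power n u) (secondDeriv ψ) := by
  have h := toDist_convLin integrable_greenKernel (u + power n u) (integral_greenKernel_mul ψ)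
  rw [nonlinearity, map_sub L2Linf.toDist, sub_apply, h, map_add L2Linf.toDist]
  simp only [add_apply, map_sub]
  ring

theorem norm_nonlinearity_sub_le (n : ℕ) {u v : L2Linf 𝕂 M} {R : ℝ} (hu : ‖u‖ ≤ R) (hv : ‖v‖ ≤ R) :
    ‖nonlinearity n u - nonlinearity n v‖ ≤ greenBound * (1 + (n + 1) * R ^ n) * ‖u - v‖ := by
  set g := (u - v) + (power n u - power n v) with hg
  have h1 : nonlinearity n u - nonlinearity n v = convLin integrable_greenKernel g - g := by
    simp only [nonlinearity, hg, map_add, map_sub]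
    abel
  have h2 : ‖g‖ ≤ (1 + (n + 1) * R ^ n) * ‖u - v‖ := by
    refine (norm_add_le _ _).trans ?_
    have := norm_power_sub_le n hu hv
    linarith
  calc _ ≤ ‖convLin integrable_greenKernel g‖ + ‖g‖ := by rw [h1]; exact norm_sub_le _ _
    _ ≤ greenBound * ‖g‖ := by
      have := norm_convLin_le integrable_greenKernel g
      rw [greenBound]
      linarith
    _ ≤ _ := by
      rw [mul_assoc]
      exact mul_le_mul_of_nonneg_left h2 greenBound_nonneg

theorem norm_nonlinearity_le (n : ℕ) {u : L2Linf 𝕂 M} {R : ℝ} (hu : ‖u‖ ≤ R) :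
    ‖nonlinearity n u‖ ≤ greenBound * (R + R ^ (n + 1)) := by
  have h1 : ‖u + power n u‖ ≤ R + R ^ (n + 1) :=
    (norm_add_le _ _).trans (add_le_add hu ((norm_power_le n u).trans (by gcongr)))
  refine (norm_sub_le _ _).trans ?_
  have h2 := norm_convLin_le integrable_greenKernel (u + power n u)
  calc _ ≤ greenBound * ‖u + power n u‖ := by
        rw [greenBound]
        linarith
    _ ≤ _ := mul_le_mul_of_nonneg_left h1 greenBound_nonneg

/-- Solutions with data of size `R` exist on a time interval of length comparable to `R ^ (-n)`,
and their velocity is approximated by its Taylor polynomial with a bounded error. -/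
theorem exists_regularSolution (𝕂 : Subalgebra ℝ ℂ) (M : SpatialDomain) {n : ℕ} (hn : n ≠ 0) :
    ∃ c D : ℝ, 0 < c ∧ 0 ≤ D ∧ ∀ R : ℝ, 1 ≤ R → ∀ u₀ v₀ : L2Linf 𝕂 M, ‖u₀‖ ≤ 3 * R → ‖v₀‖ ≤ R →
      ∀ τ : ℝ, τ = (c * R ^ n)⁻¹ → ∃ u v w : ℝ → L2Linf 𝕂 M, IsRegularSolution (n + 1) τ u v w ∧
        u 0 = u₀ ∧ v 0 = v₀ ∧ ‖v τ - v₀ - τ • nonlinearity n u₀‖ ≤ D := by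
  have hg := greenBound_nonneg
  -- On the ball of radius `R` about the data the vector field is at most `2 R` in position and
  -- `greenBound (4 R + (4 R)^(n+1))` in velocity, hence at most `c R^(n+1)`: in time `1 / (c R^n)`
  -- a trajectory moves by at most `R`. Its Lipschitz constant there is at most `K₀ R^n`.
  set c : ℝ := 2 + greenBound * (4 + 4 ^ (n + 1)) with hc
  set K₀ : ℝ := 1 + greenBound * (1 + (n + 1) * 4 ^ n) with hK₀
  have hcpos : 0 < c := by positivity
  have hK₀pos : 0 < K₀ := by positivity
  refine ⟨c, K₀ * (2 / c ^ 2), hcpos, by positivity, fun R hR u₀ v₀ hu₀ hv₀ τ hτ => ?_⟩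
  have hR0 : 0 < R := by linarith
  have hRn : 1 ≤ R ^ n := one_le_pow₀ hR
  have hRn1 : R ≤ R ^ n := le_self_pow₀ hR hn
  have hτ0 : 0 < τ := by
    rw [hτ]
    positivity
  have hcτ : c * (R ^ n * τ) = 1 := by
    rw [hτ]
    field_simp
  have hball : ∀ x ∈ Metric.closedBall (u₀, v₀) R, ‖x.1‖ ≤ 4 * R ∧ ‖x.2‖ ≤ 2 * R := by
    intro x hx
    rw [mem_closedBall_iff_norm, Prod.norm_def, max_le_iff] at hx
    have h1 := norm_le_insert' x.1 u₀
    have h2 := norm_le_insert' x.2 v₀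
    have h3 : ‖x.1 - u₀‖ ≤ R := hx.1
    have h4 : ‖x.2 - v₀‖ ≤ R := hx.2
    constructor <;> linarith
  have hLip : ∀ x y : L2Linf 𝕂 M, ‖x‖ ≤ 4 * R → ‖y‖ ≤ 4 * R →
      ‖nonlinearity n x - nonlinearity n y‖ ≤ K₀ * R ^ n * ‖x - y‖ := by
    intro x y hx hy
    refine (norm_nonlinearity_sub_le n hx hy).trans ?_
    refine mul_le_mul_of_nonneg_right ?_ (norm_nonneg _)
    rw [hK₀, mul_pow]
    have : greenBound * 1 ≤ greenBound * R ^ n := mul_le_mul_of_nonneg_left hRn hg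
    nlinarith
  obtain ⟨z, hz0, hz⟩ := exists_autonomous_solution (E := L2Linf 𝕂 M × L2Linf 𝕂 M)
    (f := fun x => (x.2, nonlinearity n x.1)) (x₀ := (u₀, v₀)) (R := R) (L := c * R ^ (n + 1))
    (K := K₀ * R ^ n) (τ := τ) hR0.le (by positivity) hτ0.le (by
      intro x hx y hy
      rw [Prod.norm_def]
      refine max_le ?_ ?_
      · have h1 : ‖x.2 - y.2‖ ≤ ‖x - y‖ := norm_snd_le (x - y)
        have h2 : 1 ≤ K₀ * R ^ n := by
          have : 1 ≤ K₀ := by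
            rw [hK₀]
            have : 0 ≤ greenBound * (1 + (n + 1) * 4 ^ n) := by positivity
            linarith
          nlinarith
        exact h1.trans (le_mul_of_one_le_left (norm_nonneg _) h2)
      · refine (hLip _ _ (hball x hx).1 (hball y hy).1).trans ?_
        exact mul_le_mul_of_nonneg_left (norm_fst_le (x - y)) (by positivity)) (by positivity) (by
      intro x hx
      have hRR : R ≤ R ^ (n + 1) := le_self_pow₀ hR n.succ_ne_zero
      rw [Prod.norm_def]
      refine max_le ?_ ?_
      · refine (hball x hx).2.trans ?_
        have : 0 ≤ greenBound * (4 + 4 ^ (n + 1)) * R ^ (n + 1) := by positivity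
        rw [hc]
        linarith
      · refine (norm_nonlinearity_le n (hball x hx).1).trans ?_
        rw [hc, mul_pow]
        have : greenBound * R ≤ greenBound * R ^ (n + 1) := mul_le_mul_of_nonneg_left hRR hg
        have : 0 ≤ R ^ (n + 1) := by positivity
        linarith) (by
      rw [pow_succ]
      calc c * (R ^ n * R) * τ = c * (R ^ n * τ) * R := by ring
        _ ≤ R := by rw [hcτ, one_mul])
  have hu : ∀ t ∈ Set.Icc (-τ) τ, HasDerivWithinAt (fun t => (z t).1) (z t).2 (Set.Icc (-τ) τ) t :=
    fun t ht => (hz t ht).1.fst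
  have hv : ∀ t ∈ Set.Icc (-τ) τ,
      HasDerivWithinAt (fun t => (z t).2) (nonlinearity n (z t).1) (Set.Icc (-τ) τ) t :=
    fun t ht => (hz t ht).1.snd
  have hb : ∀ t ∈ Set.Icc (-τ) τ, ‖(z t).1‖ ≤ 4 * R ∧ ‖(z t).2‖ ≤ 2 * R := fun t ht =>
    hball _ (hz t ht).2
  have h0 : (0 : ℝ) ∈ Set.Icc (-τ) τ := ⟨by linarith, hτ0.le⟩
  refine ⟨fun t => (z t).1, fun t => (z t).2, fun t => nonlinearity n (z t).1,
    ⟨hu, hv, ?_, ?_⟩, congrArg Prod.fst hz0, congrArg Prod.snd hz0, ?_⟩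
  · have hlip : LipschitzOnWith (K₀ * R ^ n).toNNReal (nonlinearity n (𝕂 := 𝕂) (M := M))
        (Metric.closedBall 0 (4 * R)) := by
      refine LipschitzOnWith.of_dist_le_mul fun x hx y hy => ?_
      rw [dist_eq_norm, dist_eq_norm, Real.coe_toNNReal _ (by positivity)]
      exact hLip x y (by simpa using hx) (by simpa using hy)
    refine hlip.continuousOn.comp (fun t ht => (hu t ht).continuousWithinAt) fun t ht => ?_
    simpa using (hb t ht).1
  · intro t _ ψ
    have hd : ∀ (g : L2Linf 𝕂 M) (χ : 𝓢(ℝ, ℂ)), ∫ x, L2Linf.fn g x * χ x = L2Linf.toDist g χ :=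
      fun g χ => by
        rw [L2Linf.toDist_apply]
        simp only [mul_comm]
    have hp : ∫ x, L2Linf.fn (z t).1 x ^ (n + 1) * secondDeriv ψ x =
        L2Linf.toDist (power n (z t).1) (secondDeriv ψ) := by
      rw [← hd]
      refine integral_congr_ae ?_
      filter_upwards [fn_power n (z t).1] with x hx
      rw [hx]
    simp only [← secondDeriv_apply]
    rw [hd, hd, hd, hp]
    have := toDist_nonlinearity n (z t).1 ψ
    rw [map_sub] at this
    linear_combination this
  -- Two mean value estimates. The position moves by at most `2 R τ`, so the nonlinearity varies by
  -- at most `K₀ R^n (2 R τ)`, and the velocity departs from its linear approximation by at most `K₀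
  -- R^n (2 R τ) τ`. Since `R^n τ = 1 / c` and `R τ ≤ 1 / c`, this is bounded uniformly in `R`.
  · have hconv : Convex ℝ (Set.Icc (-τ) τ) := convex_Icc _ _
    have hτm : τ ∈ Set.Icc (-τ) τ := ⟨by linarith, le_rfl⟩
    have e1 : ∀ t ∈ Set.Icc (-τ) τ, ‖(z t).1 - u₀‖ ≤ 2 * R * τ := by
      intro t ht
      have := hconv.norm_image_sub_le_of_norm_hasDerivWithin_le hu (fun t ht => (hb t ht).2) h0 ht
      simp only [hz0] at this
      refine this.trans ?_
      have : ‖t - 0‖ ≤ τ := by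
        rw [sub_zero, Real.norm_eq_abs]
        exact abs_le.2 ht
      gcongr
    have e2 : ∀ t ∈ Set.Icc (-τ) τ, ‖nonlinearity n (z t).1 - nonlinearity n u₀‖ ≤
        K₀ * R ^ n * (2 * R * τ) := fun t ht =>
      (hLip _ _ (hb t ht).1 (by linarith)).trans
        (mul_le_mul_of_nonneg_left (e1 t ht) (by positivity))
    have e3 := hconv.norm_image_sub_le_of_norm_hasDerivWithin_le
      (f := fun t => (z t).2 - t • nonlinearity n u₀)
      (f' := fun t => nonlinearity n (z t).1 - nonlinearity n u₀)
      (fun t ht => by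
        have := (hv t ht).sub ((hasDerivWithinAt_id t (Set.Icc (-τ) τ)).smul_const (nonlinearity n u₀))
        rw [one_smul] at this
        exact this) e2 h0 hτm
    simp only [hz0, zero_smul, sub_zero] at e3
    rw [Real.norm_of_nonneg hτ0.le] at e3
    rw [sub_right_comm]
    refine e3.trans ?_
    have hτc : R * τ ≤ 1 / c := by
      rw [le_div_iff₀ hcpos]
      calc R * τ * c ≤ R ^ n * τ * c := by gcongr
        _ = 1 := by rw [mul_comm, hcτ]
    have hRτ : R ^ n * τ = 1 / c := by
      rw [eq_div_iff hcpos.ne', mul_comm, hcτ]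
    calc K₀ * R ^ n * (2 * R * τ) * τ = K₀ * (2 * (R ^ n * τ) * (R * τ)) := by ring
      _ ≤ K₀ * (2 * (1 / c) * (1 / c)) := by
        rw [hRτ]
        gcongr
      _ = K₀ * (2 / c ^ 2) := by
        field_simp

/-! ### Norm inflation and conclusion -/

theorem power_smul (n : ℕ) (r : ℝ) (g : L2Linf 𝕂 M) : power n (r • g) = r ^ (n + 1) • power n g := by
  apply ext_fn
  filter_upwards [fn_power n (r • g), fn_smul r g, fn_smul (r ^ (n + 1)) (power n g), fn_power n g]
    with x a b c d
  rw [a, b, c, d, mul_pow]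
  push_cast
  ring

theorem continuous_inclusion (hs : s < 0) :
    Continuous (inclusion hs : L2Linf 𝕂 M → W 𝕂 M s) :=
  AddMonoidHomClass.continuous_of_bound (inclusion hs : L2Linf 𝕂 M →ₗ[ℝ] W 𝕂 M s) _ fun g => by
    rw [norm_inclusion]
    exact norm_convLin_le _ g

/-- A continuous curve in `(L² ∩ L^∞)(M)` seen in `W^{s,2,∞}(M)`. -/
def curve (hs : s < 0) {τ : ℝ} {f : ℝ → L2Linf 𝕂 M} (hf : ContinuousOn f (Set.Icc (-τ) τ)) :
    C(Set.Icc (-τ) τ, W 𝕂 M s) :=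
  ⟨fun t => inclusion hs (f t),
    (continuous_inclusion hs).comp (continuousOn_iff_continuous_domRestrict.1 hf)⟩

theorem isSolution_curve (hs : s < 0) {k : ℕ} {τ : ℝ} {u v w : ℝ → L2Linf 𝕂 M}
    (h : IsRegularSolution k τ u v w) :
    IsSolution k τ (inclusion hs (u 0), inclusion hs (v 0))
      (curve hs fun t ht => (h.hasDeriv_u t ht).continuousWithinAt)
      (curve hs fun t ht => (h.hasDeriv_v t ht).continuousWithinAt) := by
  refine ⟨fun t ht => ⟨?_, ?_⟩, u, v, w, h, fun t => ⟨toDist_inclusion hs _, toDist_inclusion hs _⟩⟩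
  · change inclusion hs (u t) = inclusion hs (u 0)
    rw [ht]
  · change inclusion hs (v t) = inclusion hs (v 0)
    rw [ht]

theorem norm_perturbation (hs : s < 0) (a b g : L2Linf 𝕂 M) {r : ℝ} (hr : 0 ≤ r) :
    ‖((inclusion hs (a + r • g), inclusion hs b) : W 𝕂 M s × W 𝕂 M s) -
      (inclusion hs a, inclusion hs b)‖ = r * ‖besselOp hs g‖ := by
  rw [Prod.mk_sub_mk, sub_self, ← map_sub, add_sub_cancel_left, Prod.norm_def]
  simp only [norm_zero]
  rw [max_eq_left (norm_nonneg _), norm_inclusion, map_smul, norm_smul, Real.norm_of_nonneg hr]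

/-- Convergence with `ε = 1` confines the velocity to a unit neighbourhood of `L.2`, which bounds
its pairings independently of the size of the perturbation in `L² ∩ L^∞`. -/
theorem norm_toDist_le_of_solutionsConverge (hs : s < 0) {k : ℕ} {T : ℝ}
    {L : C(Set.Icc (-T) T, W 𝕂 M s) × C(Set.Icc (-T) T, W 𝕂 M s)}
    {p : W 𝕂 M s × W 𝕂 M s} {δ : ℝ} (hconv : ∀ q : W 𝕂 M s × W 𝕂 M s, ‖q - p‖ < δ →
      ∀ (τ : ℝ) (_ : 0 < τ) (hτT : τ ≤ T) (U V : C(Set.Icc (-τ) τ, W 𝕂 M s)),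
      IsSolution k τ q U V → ∀ t : Set.Icc (-τ) τ,
        ‖U t - L.1 (Set.inclusion (Set.Icc_subset_Icc (neg_le_neg hτT) hτT) t)‖ < 1 ∧
        ‖V t - L.2 (Set.inclusion (Set.Icc_subset_Icc (neg_le_neg hτT) hτT) t)‖ < 1)
    {φ : 𝓢(ℝ, ℂ)} {C : ℝ} (hC : 0 ≤ C) (hφ : ∀ f : W 𝕂 M s, ‖f.toDist φ‖ ≤ C * ‖f‖)
    {τ : ℝ} (hτ : 0 < τ) (hτT : τ ≤ T) {u v w : ℝ → L2Linf 𝕂 M} (h : IsRegularSolution k τ u v w)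
    (hq : ‖((inclusion hs (u 0), inclusion hs (v 0)) : W 𝕂 M s × W 𝕂 M s) - p‖ < δ) :
    ∀ t ∈ Set.Icc (-τ) τ, ‖L2Linf.toDist (v t) φ‖ ≤ C * (‖L.2‖ + 1) := by
  intro t ht
  have h1 := (hconv _ hq τ hτ hτT _ _ (isSolution_curve hs h) ⟨t, ht⟩).2
  have h2 : ‖(inclusion hs (v t) : W 𝕂 M s)‖ ≤ ‖L.2‖ + 1 := by
    have h3 := norm_le_insert' (inclusion hs (v t) : W 𝕂 M s)
      (L.2 (Set.inclusion (Set.Icc_subset_Icc (neg_le_neg hτT) hτT) ⟨t, ht⟩))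
    have h4 := L.2.norm_coe_le_norm
      (Set.inclusion (Set.Icc_subset_Icc (neg_le_neg hτT) hτT) ⟨t, ht⟩)
    have h5 : ‖(inclusion hs (v t) : W 𝕂 M s) -
      L.2 (Set.inclusion (Set.Icc_subset_Icc (neg_le_neg hτT) hτT) ⟨t, ht⟩)‖ < 1 := h1
    linarith
  have h3 := hφ (inclusion hs (v t))
  rw [toDist_inclusion] at h3
  exact h3.trans (mul_le_mul_of_nonneg_left h2 hC)

theorem toDist_smul_apply (r : ℝ) (f : L2Linf 𝕂 M) (χ : 𝓢(ℝ, ℂ)) :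
    L2Linf.toDist (r • f) χ = (r : ℂ) * L2Linf.toDist f χ := by
  rw [map_smul, ← Complex.real_smul]
  rfl

theorem toDist_sub_apply (f g : L2Linf 𝕂 M) (χ : 𝓢(ℝ, ℂ)) :
    L2Linf.toDist (f - g) χ = L2Linf.toDist f χ - L2Linf.toDist g χ := by
  rw [map_sub]
  rfl

/-- Solves the Taylor expansion of the velocity, paired with `ψ - ψ''`, for the contribution of `(R
g)^(n+1)`; here `z` stands for the velocity at time `τ`. -/
theorem dominant_term_le (n : ℕ) (a b z g : L2Linf 𝕂 M) {τ R : ℝ} (hτ : 0 ≤ τ) (hR : 0 ≤ R)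
    (ψ : 𝓢(ℝ, ℂ)) :
    τ * (R ^ (n + 1) * ‖L2Linf.toDist (power n g) (secondDeriv ψ)‖) ≤
      ‖L2Linf.toDist z (ψ - secondDeriv ψ)‖ + ‖L2Linf.toDist b (ψ - secondDeriv ψ)‖ +
      ‖L2Linf.toDist (z - b - τ • nonlinearity n (a + R • g)) (ψ - secondDeriv ψ)‖ +
      τ * ‖L2Linf.toDist (a + R • g) (secondDeriv ψ)‖ +
      τ * ‖L2Linf.toDist (power n (a + R • g) - power n (R • g)) (secondDeriv ψ)‖ := by
  have h := toDist_nonlinearity n (a + R • g) ψ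
  generalize a + R • g = u₀ at *
  generalize ψ - secondDeriv ψ = φ at *
  rw [toDist_sub_apply, toDist_sub_apply z b, toDist_smul_apply, h, toDist_sub_apply, power_smul,
    toDist_smul_apply]
  generalize L2Linf.toDist z φ = c₁
  generalize L2Linf.toDist b φ = c₂
  generalize L2Linf.toDist u₀ (secondDeriv ψ) = c₃
  generalize L2Linf.toDist (power n u₀) (secondDeriv ψ) = c₄
  generalize L2Linf.toDist (power n g) (secondDeriv ψ) = c₅
  have hn : ∀ (r : ℝ), 0 ≤ r → ∀ z : ℂ, r * ‖z‖ = ‖(r : ℂ) * z‖ := fun r hr z => by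
    rw [norm_mul, Complex.norm_real, Real.norm_of_nonneg hr]
  rw [hn _ (by positivity), hn _ hτ, hn _ hτ, hn _ hτ, Complex.norm_mul, Complex.norm_mul]
  have e : (τ : ℂ) * (((R ^ (n + 1) : ℝ) : ℂ) * c₅) = c₁ - c₂ - (c₁ - c₂ - τ * (c₃ + c₄)) - τ * c₃ -
      τ * (c₄ - ((R ^ (n + 1) : ℝ) : ℂ) * c₅) := by ring
  have f1 := norm_sub_le (c₁ - c₂ - (c₁ - c₂ - τ * (c₃ + c₄)) - τ * c₃)
    (τ * (c₄ - ((R ^ (n + 1) : ℝ) : ℂ) * c₅))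
  have f2 := norm_sub_le (c₁ - c₂ - (c₁ - c₂ - τ * (c₃ + c₄))) (τ * c₃)
  have f3 := norm_sub_le (c₁ - c₂) (c₁ - c₂ - τ * (c₃ + c₄))
  have f4 := norm_sub_le c₁ c₂
  rw [← e] at f1
  simp only [Complex.norm_mul] at *
  linarith

/-- All remaining terms are bounded in `R`: the linear one is `O(τ R)`, and the difference of `(a +
R g)^(n+1)` and `(R g)^(n+1)` is only `O(R^n ‖a‖)`, one power of `R` below the main term. -/
theorem growth_le (n : ℕ) (a b z g : L2Linf 𝕂 M) {τ R c κ B D : ℝ} (hτ : 0 ≤ τ)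
    (hR : 0 ≤ R) {ψ : 𝓢(ℝ, ℂ)} (hg : ‖g‖ ≤ 2) (hu : ‖a + R • g‖ ≤ 3 * R)
    (hτR : τ * R ^ n = 1 / c) (hτR' : τ * R ≤ 1 / c)
    (hκ : κ ≤ ‖L2Linf.toDist (power n g) (secondDeriv ψ)‖)
    (hz : ‖L2Linf.toDist z (ψ - secondDeriv ψ)‖ ≤ B)
    (hb : ‖L2Linf.toDist b (ψ - secondDeriv ψ)‖ ≤ B)
    (hest : ‖z - b - τ • nonlinearity n (a + R • g)‖ ≤ D) :
    τ * (R ^ (n + 1) * κ) ≤ 2 * B + (∫ x, ‖(ψ - secondDeriv ψ) x‖) * D +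
      ((∫ x, ‖secondDeriv ψ x‖) * 3 + (∫ x, ‖secondDeriv ψ x‖) * ((n + 1) * 3 ^ n * ‖a‖)) / c := by
  have hRg : ‖R • g‖ ≤ 3 * R := by
    rw [norm_smul, Real.norm_of_nonneg hR]
    nlinarith
  have hpow : ‖power n (a + R • g) - power n (R • g)‖ ≤ (n + 1) * (3 * R) ^ n * ‖a‖ := by
    have := norm_power_sub_le n hu hRg
    rwa [add_sub_cancel_right] at this
  have e1 := dominant_term_le n a b z g hτ hR ψ
  have e2 := norm_toDist_apply_le (z - b - τ • nonlinearity n (a + R • g)) (ψ - secondDeriv ψ)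
  have e3 := norm_toDist_apply_le (a + R • g) (secondDeriv ψ)
  have e4 := norm_toDist_apply_le (power n (a + R • g) - power n (R • g)) (secondDeriv ψ)
  have hP : 0 ≤ ∫ x, ‖(ψ - secondDeriv ψ) x‖ := integral_nonneg fun _ => norm_nonneg _
  have hΘ : 0 ≤ ∫ x, ‖secondDeriv ψ x‖ := integral_nonneg fun _ => norm_nonneg _
  generalize (∫ x, ‖(ψ - secondDeriv ψ) x‖) = P at *
  generalize (∫ x, ‖secondDeriv ψ x‖) = Θ at *
  have f2 := e2.trans (mul_le_mul_of_nonneg_left hest hP)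
  have f3 := mul_le_mul_of_nonneg_left (e3.trans (mul_le_mul_of_nonneg_left hu hΘ)) hτ
  have f4 := mul_le_mul_of_nonneg_left (e4.trans (mul_le_mul_of_nonneg_left hpow hΘ)) hτ
  have f5 := mul_le_mul_of_nonneg_left (mul_le_mul_of_nonneg_left hκ (pow_nonneg hR (n + 1))) hτ
  refine (f5.trans e1).trans ?_
  generalize ‖L2Linf.toDist z (ψ - secondDeriv ψ)‖ = c₁ at *
  generalize ‖L2Linf.toDist b (ψ - secondDeriv ψ)‖ = c₂ at *
  refine (add_le_add (add_le_add (add_le_add (add_le_add hz hb) f2) f3) f4).trans ?_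
  have f6 : τ * (Θ * (3 * R)) ≤ Θ * 3 / c := by
    calc τ * (Θ * (3 * R)) = Θ * 3 * (τ * R) := by ring
      _ ≤ Θ * 3 * (1 / c) := by gcongr
      _ = _ := by ring
  have f7 : τ * (Θ * ((n + 1) * (3 * R) ^ n * ‖a‖)) = Θ * ((n + 1) * 3 ^ n * ‖a‖) / c := by
    calc _ = Θ * ((n + 1) * 3 ^ n * ‖a‖) * (τ * R ^ n) := by
          rw [mul_pow]
          ring
      _ = _ := by
          rw [hτR]
          ring
  rw [f7, add_div]
  linarith

set_option maxHeartbeats 400000 in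
theorem not_solutionMapContinuousAt {n : ℕ} (hn : n ≠ 0) (hs : s < 0) {T : ℝ} (hT : 0 < T)
    (p : W 𝕂 M s × W 𝕂 M s) : ¬ SolutionMapContinuousAt (n + 1) T p := by
  rintro ⟨hp, L, hL⟩
  obtain ⟨δ, hδ, hconv⟩ := hL 1 one_pos
  obtain ⟨q, ⟨⟨a, ha⟩, b, hb⟩, hpq⟩ := Metric.mem_closure_iff.1 hp (δ / 2) (by positivity)
  have hqa : q.1 = inclusion hs a := W.toDist_injective (by rw [ha, toDist_inclusion])
  have hqb : q.2 = inclusion hs b := W.toDist_injective (by rw [hb, toDist_inclusion])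
  obtain ⟨ψ, κ, hκ, hosc⟩ := exists_oscillating_data 𝕂 M hs hn
  obtain ⟨c, D, hc, hD, hsol⟩ := exists_regularSolution 𝕂 M hn
  obtain ⟨Cφ, hCφ, hφ⟩ := W.exists_norm_toDist_apply_le (𝕂 := 𝕂) (M := M) (s := s)
    (ψ - secondDeriv ψ)
  set φ := ψ - secondDeriv ψ with hφdef
  set B : ℝ := ‖L.2‖ + 1 with hB
  set P : ℝ := ∫ x, ‖φ x‖ with hP
  set Θ : ℝ := ∫ x, ‖secondDeriv ψ x‖ with hΘ
  have hP0 : 0 ≤ P := integral_nonneg fun _ => norm_nonneg _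
  have hΘ0 : 0 ≤ Θ := integral_nonneg fun _ => norm_nonneg _
  have hB0 : 0 ≤ B := by positivity
  set Q : ℝ := 2 * (Cφ * B) + P * D + (Θ * 3 + Θ * ((n + 1) * 3 ^ n * ‖a‖)) / c with hQ
  have hQ0 : 0 ≤ Q := by positivity
  -- The summands make `R` dominate the sizes of `a` and `b`, force `τ ≤ T` through `1 / (c T)`, and
  -- strictly exceed `Q c / κ`, the largest value of `R` compatible with the bound `R κ / c ≤ Q`.
  set R : ℝ := 1 + ‖a‖ + ‖b‖ + 1 / (c * T) + Q * c / κ with hR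
  have hna := norm_nonneg a
  have hnb := norm_nonneg b
  have hcT : 0 < 1 / (c * T) := by positivity
  have hQκ : 0 ≤ Q * c / κ := by positivity
  have hR1 : 1 ≤ R := by linarith
  have hR0 : 0 < R := by linarith
  have hRn : R ≤ R ^ n := le_self_pow₀ hR1 hn
  -- The profile is chosen after `R`: its frequency absorbs the factor `R`, so that the perturbed
  -- data stay within `δ` of `p`, while `κ` does not depend on it.
  obtain ⟨g, hg2, hgδ, hgκ⟩ := hosc (δ / 2 / R) (by positivity)
  set u₀ := a + R • g with hu₀
  have hRg : ‖R • g‖ ≤ 2 * R := by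
    rw [norm_smul, Real.norm_of_nonneg hR0.le, mul_comm]
    exact mul_le_mul_of_nonneg_right hg2 hR0.le
  have hu₀R : ‖u₀‖ ≤ 3 * R := by
    have := norm_add_le a (R • g)
    linarith
  set τ : ℝ := (c * R ^ n)⁻¹ with hτ
  have hτ0 : 0 < τ := by positivity
  have hτT : τ ≤ T := by
    have h1 : 1 ≤ c * T * R := by
      have : 1 / (c * T) ≤ R := by linarith
      rwa [div_le_iff₀' (by positivity)] at this
    rw [hτ]
    refine inv_le_of_inv_le₀ hT ?_
    rw [inv_le_iff_one_le_mul₀' hT]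
    calc 1 ≤ c * T * R := h1
      _ ≤ c * T * R ^ n := by gcongr
      _ = T * (c * R ^ n) := by ring
  obtain ⟨u, v, w, hreg, hu0, hv0, hest⟩ := hsol R hR1 u₀ b hu₀R (by linarith) τ hτ
  have hq' : ‖((inclusion hs (u 0), inclusion hs (v 0)) : W 𝕂 M s × W 𝕂 M s) - p‖ < δ := by
    have h2 := norm_perturbation hs a b g hR0.le
    rw [← hu₀, ← hqb, ← hqa] at h2
    rw [lt_div_iff₀' hR0, ← h2] at hgδ
    rw [dist_comm, dist_eq_norm] at hpq
    rw [hu0, hv0, ← hqb]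
    calc _ ≤ _ := norm_sub_le_norm_sub_add_norm_sub _ q _
      _ < δ / 2 + δ / 2 := add_lt_add hgδ hpq
      _ = δ := add_halves δ
  have hVB := norm_toDist_le_of_solutionsConverge hs hconv hCφ hφ hτ0 hτT hreg hq'
  have hB1 := hVB τ ⟨by linarith, le_rfl⟩
  -- At time zero the same bound controls the pairing of the initial velocity `b`.
  have hB2 := hVB 0 ⟨by linarith, hτ0.le⟩
  rw [hv0] at hB2
  have hτR : τ * R ^ n = 1 / c := by
    rw [hτ]
    field_simp
  have hτR' : τ * R ≤ 1 / c := by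
    rw [← hτR]
    gcongr
  have hmain : τ * (R ^ (n + 1) * κ) ≤ Q :=
    growth_le n a b (v τ) g hτ0.le hR0.le hg2 hu₀R hτR hτR' hgκ hB1 hB2 hest
  have hlow : τ * (R ^ (n + 1) * κ) = R * κ / c := by
    calc τ * (R ^ (n + 1) * κ) = τ * R ^ n * (R * κ) := by ring
      _ = _ := by
        rw [hτR]
        ring
  rw [hlow, div_le_iff₀ hc] at hmain
  have : R ≤ Q * c / κ := by rwa [le_div_iff₀ hκ]
  linarith

end GIBq

end

theorem corollary1p2 (𝕂 : Subalgebra ℝ ℂ) (M : GIBq.SpatialDomain) (k : ℕ) (hk : 2 ≤ k)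
    (s : ℝ) (hs : s < 0) (T : ℝ) (hT : 0 < T) (p : GIBq.W 𝕂 M s × GIBq.W 𝕂 M s) :
    ¬ GIBq.SolutionMapContinuousAt k T p := by
  obtain ⟨n, rfl⟩ : ∃ n, k = n + 1 := ⟨k - 1, by omega⟩
  exact GIBq.not_solutionMapContinuousAt (by omega) hs hT p
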